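/- **Theorem (Soundness).** *Setting.* Let $\mathcal P$ be a protocol: an order-sorted signature with sorts $\mathsf{Msg}$ and $\mathsf{Fresh}$, a set $E_{\mathcal P}$ of equations, and for each of finitely many roles $ro$ one well-formed process built from $+M$, $-M$, sequential composition, $P\,?\,Q$ and $\mathit{if}\ T\ \mathit{then}\ P\ \mathit{else}\ Q$, where $T$ is $M=M'$ or $M\neq M'$. Messages are terms of sort $\mathsf{Msg}$ modulo $E_{\mathcal P}$. In session $i$ of role $ro$ a fresh variable $r$ is replaced by its unique name $r.ro.i$. Three semantics are considered. 1. *Process algebra semantics.* States consist of labeled processes and the messages known to the intruder; labeled transitions execute the next action of a process (a sent message may or may not be learnt by the intruder, a received one must be known) or introduce a new session. The initial state $P_{init}$ is empty. A PA-State is a state reachable from $P_{init}$. 2. *Constrained forwards strand semantics.* Every process is deconstructed into the set of its execution paths (constrained strands), in which a choice is recorded as $\{?,1\}$, $\{?,2\}$, $\{T,1\}$ or $\{\neg T,2\}$. States consist of the executed parts $(ro,i)[v_1,\ldots,v_k]$ of ground instances of these strands and the messages known to the intruder; transitions carry the same kind of labels as in 1. The initial state $F_{init}$ is empty. An FW-State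 is a state reachable from $F_{init}$. For a PA-State $Pst$ and an FW-State $Fst$, $Pst\ \mathcal H\ Fst$ means that there is a label sequence $\alpha$ with $P_{init}\to_\alpha Pst$ and $F_{init}\to_\alpha Fst$. 3. *Constrained backwards semantics.* A constrained symbolic strand state $\langle S,\Psi\rangle$ consists of symbolic strands $::r_1,\ldots,r_m::[u_1,\ldots,u_{i-1}\mid u_i,\ldots,u_n]$, each an instance modulo $E_{\mathcal P}$ of a strand of the protocol; of facts $m\in\mathcal I$ (known) and $m\notin\mathcal I$ (not yet known); of variables for further strands and further facts; and of a finite set $\Psi$ of disequalities. Here $r_1,\ldots,r_m$ are the images of the fresh variables of the protocol strand, and they are variables of sort $\mathsf{Fresh}$ that are pairwise different, also between different strands. Backwards narrowing modulo $E_{\mathcal P}$ applies in reverse the rules that move the bar over a received message (which must be known), over a sent message (learnt: $m\notin\mathcal I$ becomes $m\in\mathcal I$; or not learnt), over $\{?,n\}$, over $\{M=M,n\}$, or over $\{M\neq M',n\}$ (backwards, $M\neq M'$ is added to $\Psi$ if the result is satisfiable), and the rule that, backwards, introduces a new strand which sends a message learnt by the intruder. A state is initial if the bar is at the beginning of every strand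 and there is no fact $m\in\mathcal I$. For a ground substitution $\theta$ and a ground state $s$ of the forwards semantics, $\langle S,\Psi\rangle>^\theta s$ means: for every strand of $S$ with $i>1$ there is a strand $[v_1,\ldots,v_{i-1}]$ in $s$ with $v_j=_{E_{\mathcal P}}u_j\theta$ for all $j<i$; for every fact $m\in\mathcal I$ of $S$, $m\theta$ is known in $s$; for every fact $m\notin\mathcal I$ of $S$, $m\theta$ is not known in $s$; and $u\theta\neq_{E_{\mathcal P}}v\theta$ for every disequality $u\neq v$ in $\Psi$. *Claim.* Let $CstrS_0$ and $CstrS$ be constrained symbolic strand states of $\mathcal P$ and let $\theta$ be a ground substitution such that (i) $CstrS_0$ is initial; (ii) there is a backwards narrowing sequence $CstrS=C_0'\leadsto_{\sigma_0}C_1'\leadsto_{\sigma_1}\cdots\leadsto_{\sigma_{n-1}}C_n'=CstrS_0$, $n\ge 0$; (iii) $CstrS_0>^\theta F_{init}$; (iv) with $\mu_k=\sigma_k\sigma_{k+1}\cdots\sigma_{n-1}$, there are no $k\le n$, no fact $w\in\mathcal I$ of $C_k'$ and no fact $w'\notin\mathcal I$ of $CstrS$ with $w\mu_k\theta=_{E_{\mathcal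 P}}w'\mu_0\theta$ (this is void if $CstrS$ has no facts $m\notin\mathcal I$). Then there are an FW-State $Fst$ and a ground substitution $\theta'$ with $CstrS>^{\theta'}Fst$, and there is a PA-State $Pst$ with $Pst\ \mathcal H\ Fst$. -/

import Mathlib

namespace MaudeNPA

/-! ## Order-sorted terms modulo equations -/

/-- An order-sorted signature with a distinguished sort `msg` of messages, top sort of its
connected component, and a distinguished sort `fresh`. Operators may be overloaded:
`decl f ws s` says that `f` is declared with argument sorts `ws` and result sort `s`. -/
structure Signature where
  Srt : Type
  [order : PartialOrder Srt]
  Op : Type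
  arity : Op → ℕ
  decl : (f : Op) → (Fin (arity f) → Srt) → Srt → Prop
  msg : Srt
  fresh : Srt
  msg_top : ∀ s, Relation.EqvGen (fun a b : Srt => a ≤ b) s msg → s ≤ msg

attribute [instance] Signature.order

/-- (Unsorted) terms over a set `X` of atoms; the atoms will be variables, names of fresh
constants, or both. -/
inductive Term (S : Signature) (X : Type) : Type
  | var (x : X) : Term S X
  | app (f : S.Op) (args : Fin (S.arity f) → Term S X) : Term S X

/-- A sort for every atom. -/
class Sorted (S : Signature) (X : Type) where
  srt : X → S.Srt

/-- `HasSort t s`: the term `t` is well-formed and belongs to the sort `s`. -/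
inductive HasSort {S : Signature} {X : Type} [Sorted S X] : Term S X → S.Srt → Prop
  | var (x : X) (s : S.Srt) : Sorted.srt x ≤ s → HasSort (.var x) s
  | app (f : S.Op) (args : Fin (S.arity f) → Term S X) (ws : Fin (S.arity f) → S.Srt)
      (s s' : S.Srt) : S.decl f ws s → (∀ i, HasSort (args i) (ws i)) → s ≤ s' →
      HasSort (.app f args) s'

theorem HasSort.mono {S : Signature} {X : Type} [Sorted S X] {t : Term S X} {s s' : S.Srt}
    (h : HasSort t s) (hs : s ≤ s') : HasSort t s' := by
  cases h with
  | var x _ hx => exact .var x s' (hx.trans hs)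
  | app f args ws s₀ _ hd ha h₀ => exact .app f args ws s₀ s' hd ha (h₀.trans hs)

/-- The atoms occurring in a term. -/
def Term.atoms {S : Signature} {X : Type} : Term S X → Set X
  | .var x => {x}
  | .app _ args => ⋃ i, (args i).atoms

/-- Sorted substitutions of atoms by terms. -/
structure Subst (S : Signature) (X Y : Type) [Sorted S X] [Sorted S Y] where
  toFun : X → Term S Y
  sorted : ∀ x, HasSort (toFun x) (Sorted.srt (S := S) x)

/-- Homomorphic application of a map from atoms to terms. -/
def Term.bind {S : Signature} {X Y : Type} (σ : X → Term S Y) : Term S X → Term S Y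
  | .var x => σ x
  | .app f args => .app f fun i => (args i).bind σ

def Term.subst {S : Signature} {X Y : Type} [Sorted S X] [Sorted S Y] (t : Term S X)
    (σ : Subst S X Y) : Term S Y :=
  t.bind σ.toFun

theorem HasSort.subst {S : Signature} {X Y : Type} [Sorted S X] [Sorted S Y] {t : Term S X}
    {s : S.Srt} (h : HasSort t s) (σ : Subst S X Y) : HasSort (t.subst σ) s := by
  induction h with
  | var x s hx => exact (σ.sorted x).mono hx
  | app f args ws s s' hd _ hs ih =>
    exact .app f (fun i => (args i).subst σ) ws s s' hd ih hs

theorem Term.subst_subst {S : Signature} {X Y Z : Type} [Sorted S X] [Sorted S Y] [Sorted S Z]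
    (t : Term S X) (σ : Subst S X Y) (τ : Subst S Y Z) (υ : Subst S X Z)
    (h : ∀ x, υ.toFun x = (σ.toFun x).subst τ) : (t.subst σ).subst τ = t.subst υ := by
  induction t with
  | var x => exact (h x).symm
  | app f args ih => exact congrArg (Term.app f) (funext ih)

/-- The identity substitution. -/
def Subst.id (S : Signature) (X : Type) [Sorted S X] : Subst S X X where
  toFun := .var
  sorted x := .var x _ le_rfl

/-- Composition: first `σ`, then `τ`. -/
def Subst.comp {S : Signature} {X Y Z : Type} [Sorted S X] [Sorted S Y] [Sorted S Z]
    (σ : Subst S X Y) (τ : Subst S Y Z) : Subst S X Z where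
  toFun x := (σ.toFun x).subst τ
  sorted x := (σ.sorted x).subst τ

/-- Variables: countably infinitely many of each sort. The variables of sort `fresh` are the
fresh variables; the choice and pattern variables are variables of other sorts. -/
structure Var (S : Signature) : Type where
  srt : S.Srt
  idx : ℕ

instance (S : Signature) : Sorted S (Var S) := ⟨Var.srt⟩

/-- The fresh variable with index `k`. -/
def freshVar (S : Signature) (k : ℕ) : Var S := ⟨S.fresh, k⟩

/-- The unique name `r.ro.i` of the constant of sort `fresh` that stands for the fresh variable
`r` (given by its index) in session `i` of role `ro`. -/
structure Name (Role : Type) : Type where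
  idx : ℕ
  role : Role
  session : ℕ

instance (S : Signature) (Role : Type) : Sorted S (Name Role) := ⟨fun _ => S.fresh⟩

instance (S : Signature) (X Y : Type) [Sorted S X] [Sorted S Y] : Sorted S (X ⊕ Y) :=
  ⟨Sum.elim Sorted.srt Sorted.srt⟩

/-- The congruence generated on terms by a set `E` of equations (order-sorted equational
logic). -/
inductive EqE {S : Signature} (E : Set (Term S (Var S) × Term S (Var S))) {X : Type}
    [Sorted S X] : Term S X → Term S X → Prop
  | refl (t) : EqE E t t
  | symm {t u} : EqE E t u → EqE E u t
  | trans {t u v} : EqE E t u → EqE E u v → EqE E t v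
  | ax (l r) (σ : Subst S (Var S) X) : (l, r) ∈ E → EqE E (l.subst σ) (r.subst σ)
  | congr (f : S.Op) (a b : Fin (S.arity f) → Term S X) (ws : Fin (S.arity f) → S.Srt)
      (s : S.Srt) : S.decl f ws s → (∀ i, HasSort (a i) (ws i)) → (∀ i, HasSort (b i) (ws i)) →
      (∀ i, EqE E (a i) (b i)) → EqE E (.app f a) (.app f b)

theorem EqE.subst {S : Signature} {E : Set (Term S (Var S) × Term S (Var S))} {X Y : Type}
    [Sorted S X] [Sorted S Y] {t u : Term S X} (h : EqE E t u) (τ : Subst S X Y) :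
    EqE E (t.subst τ) (u.subst τ) := by
  induction h with
  | refl t => exact .refl _
  | symm _ ih => exact .symm ih
  | trans _ _ ih₁ ih₂ => exact .trans ih₁ ih₂
  | ax l r σ h =>
    rw [Term.subst_subst l σ τ (σ.comp τ) (fun _ => rfl),
      Term.subst_subst r σ τ (σ.comp τ) (fun _ => rfl)]
    exact .ax l r _ h
  | congr f a b ws s hd ha hb _ ih =>
    exact .congr f (fun i => (a i).subst τ) (fun i => (b i).subst τ) ws s hd
      (fun i => (ha i).subst τ) (fun i => (hb i).subst τ) ih

/-- Terms of sort `msg`. -/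
def MTerm (S : Signature) (X : Type) [Sorted S X] : Type :=
  {t : Term S X // HasSort t S.msg}

def MTerm.subst {S : Signature} {X Y : Type} [Sorted S X] [Sorted S Y] (m : MTerm S X)
    (σ : Subst S X Y) : MTerm S Y :=
  ⟨m.1.subst σ, m.2.subst σ⟩

def MTerm.atoms {S : Signature} {X : Type} [Sorted S X] (m : MTerm S X) : Set X :=
  m.1.atoms

/-- Equality of message terms modulo the equations. -/
def msgSetoid {S : Signature} (E : Set (Term S (Var S) × Term S (Var S))) (X : Type)
    [Sorted S X] : Setoid (MTerm S X) where
  r m n := EqE E m.1 n.1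
  iseqv := ⟨fun _ => .refl _, fun h => .symm h, fun h h' => .trans h h'⟩

/-- Messages: terms of sort `msg` modulo the equations `E`. -/
def Message {S : Signature} (E : Set (Term S (Var S) × Term S (Var S))) (X : Type)
    [Sorted S X] : Type :=
  Quotient (msgSetoid E X)

/-- The class of a term of sort `msg`. -/
def MTerm.cls {S : Signature} (E : Set (Term S (Var S) × Term S (Var S))) {X : Type}
    [Sorted S X] (m : MTerm S X) : Message E X :=
  Quotient.mk (msgSetoid E X) m

def Message.subst {S : Signature} {E : Set (Term S (Var S) × Term S (Var S))} {X Y : Type}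
    [Sorted S X] [Sorted S Y] (m : Message E X) (σ : Subst S X Y) : Message E Y :=
  Quotient.map (sa := msgSetoid E X) (sb := msgSetoid E Y) (fun n : MTerm S X => n.subst σ)
    (fun _ _ h => EqE.subst h σ) m

/-! ## Processes -/

/-- Constraints of a deterministic choice. -/
inductive Cond (α : Type) : Type
  | eq (a b : α) : Cond α
  | neq (a b : α) : Cond α

def Cond.map {α β : Type} (f : α → β) : Cond α → Cond β
  | .eq a b => .eq (f a) (f b)
  | .neq a b => .neq (f a) (f b)

/-- The negation of a constraint. -/
def Cond.neg {α : Type} : Cond α → Cond α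
  | .eq a b => .neq a b
  | .neq a b => .eq a b

def Cond.Holds {α : Type} : Cond α → Prop
  | .eq a b => a = b
  | .neq a b => a ≠ b

def Cond.atoms {S : Signature} {X : Type} [Sorted S X] : Cond (MTerm S X) → Set X
  | .eq a b => a.atoms ∪ b.atoms
  | .neq a b => a.atoms ∪ b.atoms

/-- Processes with messages in `α`, up to the axioms that make sequential composition an
associative operation with identity `nilP`: `send M P` is `+M · P`, `recv M P` is `-M · P`,
`ite T P Q R` is `(if T then P else Q) · R`, and `choice P Q R` is `(P ? Q) · R`. -/
inductive Proc (α : Type) : Type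
  | nilP : Proc α
  | send (M : α) (P : Proc α) : Proc α
  | recv (M : α) (P : Proc α) : Proc α
  | ite (T : Cond α) (P Q R : Proc α) : Proc α
  | choice (P Q R : Proc α) : Proc α

/-- Sequential composition. -/
def Proc.seq {α : Type} : Proc α → Proc α → Proc α
  | .nilP, K => K
  | .send M P, K => .send M (P.seq K)
  | .recv M P, K => .recv M (P.seq K)
  | .ite T P Q R, K => .ite T P Q (R.seq K)
  | .choice P Q R, K => .choice P Q (R.seq K)

def Proc.map {α β : Type} (f : α → β) : Proc α → Proc β
  | .nilP => .nilP
  | .send M P => .send (f M) (P.map f)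
  | .recv M P => .recv (f M) (P.map f)
  | .ite T P Q R => .ite (T.map f) (P.map f) (Q.map f) (R.map f)
  | .choice P Q R => .choice (P.map f) (Q.map f) (R.map f)

/-- All atoms of a process. -/
def Proc.atoms {S : Signature} {X : Type} [Sorted S X] : Proc (MTerm S X) → Set X
  | .nilP => ∅
  | .send M P => M.atoms ∪ P.atoms
  | .recv M P => M.atoms ∪ P.atoms
  | .ite T P Q R => T.atoms ∪ P.atoms ∪ Q.atoms ∪ R.atoms
  | .choice P Q R => P.atoms ∪ Q.atoms ∪ R.atoms

/-- The shared variables of a process, those that show up in all branches. -/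
def Proc.shVar {S : Signature} {X : Type} [Sorted S X] : Proc (MTerm S X) → Set X
  | .nilP => ∅
  | .send M P => M.atoms ∪ P.shVar
  | .recv M P => M.atoms ∪ P.shVar
  | .ite T P Q R => T.atoms ∪ (P.shVar ∩ Q.shVar) ∪ R.shVar
  | .choice P Q R => (P.shVar ∩ Q.shVar) ∪ R.shVar

/-- Well-formed processes. -/
inductive Proc.WF {S : Signature} {X : Type} [Sorted S X] : Proc (MTerm S X) → Prop
  | nilP : Proc.WF .nilP
  | send (P : Proc (MTerm S X)) (M : MTerm S X) :
      M.atoms ∩ P.atoms ⊆ P.shVar → Proc.WF P → Proc.WF (P.seq (.send M .nilP))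
  | recv (P : Proc (MTerm S X)) (M : MTerm S X) :
      M.atoms ∩ P.atoms ⊆ P.shVar → Proc.WF P → Proc.WF (P.seq (.recv M .nilP))
  | ite (P : Proc (MTerm S X)) (T : Cond (MTerm S X)) (Q R : Proc (MTerm S X)) :
      P ≠ .nilP → Q ≠ .nilP → T.atoms ⊆ P.shVar → Proc.WF (P.seq Q) → Proc.WF (P.seq R) →
      Proc.WF (P.seq (.ite T Q R .nilP))
  | choice (P Q R : Proc (MTerm S X)) :
      Q ≠ .nilP ∨ R ≠ .nilP → Proc.WF (P.seq Q) → Proc.WF (P.seq R) →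
      Proc.WF (P.seq (.choice Q R .nilP))

/-- A protocol specification in the process algebra: a signature and equations for messages, and
one well-formed process for each of finitely many roles (roles of honest principals and
capabilities of the intruder). -/
structure Protocol where
  sig : Signature
  eqs : Set (Term sig (Var sig) × Term sig (Var sig))
  eqs_sorted : ∀ e ∈ eqs, ∃ s, HasSort e.1 s ∧ HasSort e.2 s
  Role : Type
  roles : Finset Role
  proc : Role → Proc (MTerm sig (Var sig))
  proc_wf : ∀ ro ∈ roles, (proc ro).WF
  sort_nonempty : ∀ s, ∃ t : Term sig (Name Role), HasSort t s

/-- Symbolic messages. -/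
abbrev Protocol.SMes (P : Protocol) : Type := Message P.eqs (Var P.sig)

/-- Ground messages; the names of fresh constants are ground. -/
abbrev Protocol.GMes (P : Protocol) : Type := Message P.eqs (Name P.Role)

/-- The message terms of partially executed processes, which contain variables not yet bound and
names of fresh constants. -/
abbrev Protocol.PTerm (P : Protocol) : Type := MTerm P.sig (Var P.sig ⊕ Name P.Role)

/-- Symbolic substitutions. -/
abbrev Protocol.SSubst (P : Protocol) : Type := Subst P.sig (Var P.sig) (Var P.sig)

/-- Ground substitutions. -/
abbrev Protocol.GSubst (P : Protocol) : Type := Subst P.sig (Var P.sig) (Name P.Role)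

/-! ## Transition labels -/

/-- The action of a transition: the message is sent and learnt, sent and not learnt, or received;
a nondeterministic choice; a deterministic choice with its constraint. -/
inductive Action (α : Type) : Type
  | sendLearn (m : α) : Action α
  | sendOnly (m : α) : Action α
  | recv (m : α) : Action α
  | nondet : Action α
  | cond (T : Cond α) : Action α

/-- A transition label `(ro, i, j, a, n)`. -/
structure Label (P : Protocol) : Type where
  role : P.Role
  id : ℕ
  step : ℕ
  act : Action P.GMes
  branch : ℕ

/-- Sequences of transitions, with the sequence of their labels. -/
inductive Trace {St L : Type} (step : St → L → St → Prop) : St → List L → St → Prop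
  | nil (s : St) : Trace step s [] s
  | snoc {s t u : St} {α : List L} {a : L} :
      Trace step s α t → step t a u → Trace step s (α ++ [a]) u

/-! ## Process algebra semantics -/

/-- A labeled process `(ro, i, j) P`. -/
structure LProc (P : Protocol) : Type where
  role : P.Role
  id : ℕ
  step : ℕ
  proc : Proc P.PTerm

/-- A state of the process algebra; `ik` holds the messages `m` with `m ∈ I`. -/
structure PState (P : Protocol) : Type where
  procs : Multiset (LProc P)
  ik : Set P.GMes

def PState.init (P : Protocol) : PState P := ⟨0, ∅⟩

open Classical in
/-- The largest identifier of the given role, `0` if there is none. -/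
noncomputable def maxId {Role : Type} (ids : Multiset (Role × ℕ)) (ro : Role) : ℕ :=
  ((ids.filter fun p => p.1 = ro).map Prod.snd).sup

noncomputable def maxProcId {P : Protocol} (PS : Multiset (LProc P)) (ro : P.Role) : ℕ :=
  maxId (PS.map fun p => (p.role, p.id)) ro

open Classical in
/-- The fresh substitution `r ↦ r.ro.i`, applied to specifications. -/
noncomputable def freshSubst (P : Protocol) (ro : P.Role) (i : ℕ) :
    Subst P.sig (Var P.sig) (Var P.sig ⊕ Name P.Role) where
  toFun x := if x.srt = P.sig.fresh then .var (.inr ⟨x.idx, ro, i⟩) else .var (.inl x)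
  sorted x := by
    by_cases h : x.srt = P.sig.fresh
    · rw [if_pos h]; exact .var _ _ (le_of_eq h.symm)
    · rw [if_neg h]; exact .var _ _ le_rfl

/-- Names as atoms of partially executed processes. -/
def nameSubst (P : Protocol) : Subst P.sig (Name P.Role) (Var P.sig ⊕ Name P.Role) where
  toFun n := .var (.inr n)
  sorted n := .var _ _ le_rfl

/-- A ground substitution applied to all variables of a partially executed process. -/
def groundSubst {P : Protocol} (θ : P.GSubst) :
    Subst P.sig (Var P.sig ⊕ Name P.Role) (Name P.Role) where
  toFun := Sum.elim θ.toFun .var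
  sorted x := by
    cases x with
    | inl x => exact θ.sorted x
    | inr n => exact .var n _ le_rfl

open Classical in
/-- The ground substitution `θ` restricted to the variables of `M`. -/
noncomputable def bindSubst {P : Protocol} (M : P.PTerm) (θ : P.GSubst) :
    Subst P.sig (Var P.sig ⊕ Name P.Role) (Var P.sig ⊕ Name P.Role) where
  toFun x := if x ∈ M.atoms then ((groundSubst θ).toFun x).subst (nameSubst P) else .var x
  sorted x := by
    by_cases h : x ∈ M.atoms
    · rw [if_pos h]; exact ((groundSubst θ).sorted x).subst _
    · rw [if_neg h]; exact .var _ _ le_rfl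

/-- The ground message `M θ`. -/
def gval {P : Protocol} (M : P.PTerm) (θ : P.GSubst) : P.GMes :=
  (M.subst (groundSubst θ)).cls P.eqs

/-- The ground constraint `T`, as a constraint of partially executed processes. -/
def Cond.ofGround {P : Protocol} (T : Cond (MTerm P.sig (Name P.Role))) : Cond P.PTerm :=
  T.map fun m => m.subst (nameSubst P)

def Cond.gval {P : Protocol} (T : Cond (MTerm P.sig (Name P.Role))) : Cond P.GMes :=
  T.map fun m => m.cls P.eqs

/-- The next action of one labeled process, with its effect on the intruder knowledge. At a sent
message all its variables not yet bound are choice variables (fresh variables have been replaced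
by names when the process was introduced), and `θ` binds them. At a received message `θ` is the
matching substitution. -/
inductive ProcStep {P : Protocol} :
    LProc P → Set P.GMes → Label P → LProc P → Set P.GMes → Prop
  | sendLearn (ro : P.Role) (i j : ℕ) (M : P.PTerm) (Q : Proc P.PTerm) (IK : Set P.GMes)
      (θ : P.GSubst) : gval M θ ∉ IK →
      ProcStep ⟨ro, i, j, .send M Q⟩ IK ⟨ro, i, j, .sendLearn (gval M θ), 0⟩
        ⟨ro, i, j + 1, Q.map fun N => N.subst (bindSubst M θ)⟩ (insert (gval M θ) IK)
  | sendOnly (ro : P.Role) (i j : ℕ) (M : P.PTerm) (Q : Proc P.PTerm) (IK : Set P.GMes)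
      (θ : P.GSubst) :
      ProcStep ⟨ro, i, j, .send M Q⟩ IK ⟨ro, i, j, .sendOnly (gval M θ), 0⟩
        ⟨ro, i, j + 1, Q.map fun N => N.subst (bindSubst M θ)⟩ IK
  | recv (ro : P.Role) (i j : ℕ) (M : P.PTerm) (Q : Proc P.PTerm) (IK : Set P.GMes)
      (θ : P.GSubst) : gval M θ ∈ IK →
      ProcStep ⟨ro, i, j, .recv M Q⟩ IK ⟨ro, i, j, .recv (gval M θ), 0⟩
        ⟨ro, i, j + 1, Q.map fun N => N.subst (bindSubst M θ)⟩ IK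
  | ifThen (ro : P.Role) (i j : ℕ) (T : Cond (MTerm P.sig (Name P.Role)))
      (Q₁ Q₂ R : Proc P.PTerm) (IK : Set P.GMes) : T.gval.Holds →
      ProcStep ⟨ro, i, j, .ite T.ofGround Q₁ Q₂ R⟩ IK ⟨ro, i, j, .cond T.gval, 1⟩
        ⟨ro, i, j + 1, Q₁.seq R⟩ IK
  | ifElse (ro : P.Role) (i j : ℕ) (T : Cond (MTerm P.sig (Name P.Role)))
      (Q₁ Q₂ R : Proc P.PTerm) (IK : Set P.GMes) : ¬ T.gval.Holds →
      ProcStep ⟨ro, i, j, .ite T.ofGround Q₁ Q₂ R⟩ IK ⟨ro, i, j, .cond T.gval, 2⟩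
        ⟨ro, i, j + 1, Q₂.seq R⟩ IK
  | choice₁ (ro : P.Role) (i j : ℕ) (Q₁ Q₂ R : Proc P.PTerm) (IK : Set P.GMes) :
      ProcStep ⟨ro, i, j, .choice Q₁ Q₂ R⟩ IK ⟨ro, i, j, .nondet, 1⟩
        ⟨ro, i, j + 1, Q₁.seq R⟩ IK
  | choice₂ (ro : P.Role) (i j : ℕ) (Q₁ Q₂ R : Proc P.PTerm) (IK : Set P.GMes) :
      ProcStep ⟨ro, i, j, .choice Q₁ Q₂ R⟩ IK ⟨ro, i, j, .nondet, 2⟩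
        ⟨ro, i, j + 1, Q₂.seq R⟩ IK

/-- Transitions of the process algebra semantics: a process of the state acts, or a new process
is introduced together with its first action. -/
inductive PStep {P : Protocol} : PState P → Label P → PState P → Prop
  | old (PS : Multiset (LProc P)) (p p' : LProc P) (IK IK' : Set P.GMes) (a : Label P) :
      ProcStep p IK a p' IK' → PStep ⟨p ::ₘ PS, IK⟩ a ⟨p' ::ₘ PS, IK'⟩
  | new (PS : Multiset (LProc P)) (ro : P.Role) (p' : LProc P) (IK IK' : Set P.GMes)
      (a : Label P) : ro ∈ P.roles →
      ProcStep ⟨ro, maxProcId PS ro + 1, 1,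
        (P.proc ro).map fun M => M.subst (freshSubst P ro (maxProcId PS ro + 1))⟩ IK a p' IK' →
      PStep ⟨PS, IK⟩ a ⟨p' ::ₘ PS, IK'⟩

/-- PA-States: the reachable states of the process algebra semantics. -/
def IsPAState {P : Protocol} (s : PState P) : Prop :=
  ∃ α, Trace PStep (PState.init P) α s

/-! ## Constrained strands and the forwards semantics -/

/-- Elements of strands: sent messages, received messages, and constrained messages `{?, n}`
and `{T, n}`. -/
inductive SMsg (α : Type) : Type
  | send (M : α) : SMsg α
  | recv (M : α) : SMsg α
  | nondet (n : ℕ) : SMsg α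
  | cstr (T : Cond α) (n : ℕ) : SMsg α

def SMsg.map {α β : Type} (f : α → β) : SMsg α → SMsg β
  | .send M => .send (f M)
  | .recv M => .recv (f M)
  | .nondet k => .nondet k
  | .cstr T n => .cstr (T.map f) n

def SMsg.atoms {S : Signature} {X : Type} [Sorted S X] : SMsg (MTerm S X) → Set X
  | .send M => M.atoms
  | .recv M => M.atoms
  | .nondet _ => ∅
  | .cstr T _ => T.atoms

/-- `ToStrand Q L`: the strand `L` is one of the execution paths into which `Q` is
deconstructed. -/
inductive ToStrand {α : Type} : Proc α → List (SMsg α) → Prop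
  | nilP : ToStrand .nilP []
  | send (M : α) (Q : Proc α) (L : List (SMsg α)) :
      ToStrand Q L → ToStrand (.send M Q) (.send M :: L)
  | recv (M : α) (Q : Proc α) (L : List (SMsg α)) :
      ToStrand Q L → ToStrand (.recv M Q) (.recv M :: L)
  | ifThen (T : Cond α) (Q₁ Q₂ R : Proc α) (L : List (SMsg α)) :
      ToStrand (Q₁.seq R) L → ToStrand (.ite T Q₁ Q₂ R) (.cstr T 1 :: L)
  | ifElse (T : Cond α) (Q₁ Q₂ R : Proc α) (L : List (SMsg α)) :
      ToStrand (Q₂.seq R) L → ToStrand (.ite T Q₁ Q₂ R) (.cstr T.neg 2 :: L)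
  | choice₁ (Q₁ Q₂ R : Proc α) (L : List (SMsg α)) :
      ToStrand (Q₁.seq R) L → ToStrand (.choice Q₁ Q₂ R) (.nondet 1 :: L)
  | choice₂ (Q₁ Q₂ R : Proc α) (L : List (SMsg α)) :
      ToStrand (Q₂.seq R) L → ToStrand (.choice Q₁ Q₂ R) (.nondet 2 :: L)

/-- The strands of role `ro` in the constrained strand specification of the protocol. -/
def Protocol.strands (P : Protocol) (ro : P.Role) :
    Set (List (SMsg (MTerm P.sig (Var P.sig)))) :=
  {L | ro ∈ P.roles ∧ ToStrand (P.proc ro) L}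

/-- A ground strand `(ro, i) [v₁, …, v_k]`, executed so far. -/
structure GStrand (P : Protocol) : Type where
  role : P.Role
  id : ℕ
  msgs : List (SMsg P.GMes)

/-- A ground strand state; `ik` holds the messages `m` with `m ∈ I`. -/
structure FState (P : Protocol) : Type where
  strands : Multiset (GStrand P)
  ik : Set P.GMes

def FState.init (P : Protocol) : FState P := ⟨0, ∅⟩

noncomputable def maxStrId {P : Protocol} (SS : Multiset (GStrand P)) (ro : P.Role) : ℕ :=
  maxId (SS.map fun p => (p.role, p.id)) ro

/-- The ground message `M τ`. -/
def inst {P : Protocol} (τ : P.GSubst) (M : MTerm P.sig (Var P.sig)) : P.GMes :=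
  (M.subst τ).cls P.eqs

/-- The ground instance of a list of strand elements, modulo the equations. -/
def instL {P : Protocol} (τ : P.GSubst) (L : List (SMsg (MTerm P.sig (Var P.sig)))) :
    List (SMsg P.GMes) :=
  L.map (SMsg.map (inst τ))

/-- `τ` extends the fresh substitution `r ↦ r.ro.i`. -/
def RespectsFresh {P : Protocol} (τ : P.GSubst) (ro : P.Role) (i : ℕ) : Prop :=
  ∀ k, τ.toFun (freshVar P.sig k) = .var ⟨k, ro, i⟩

/-- The constraint tested by the deterministic choice from which `{T, n}` comes: the second
branch of a choice on `T` is recorded as `{¬T, 2}`. -/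
def testedCond {α : Type} (T : Cond α) (n : ℕ) : Cond α :=
  if n = 2 then T.neg else T

/-- Transitions of the constrained forwards strand semantics. In each rule
`pre ++ u :: post` is a strand of the specification, and the ground substitution `τ` combines the
match of the past messages, the fresh substitution, and the choice of values for the choice
variables of `u`. -/
inductive FStep {P : Protocol} : FState P → Label P → FState P → Prop
  | sendLearn (SS : Multiset (GStrand P)) (IK : Set P.GMes) (ro : P.Role) (i : ℕ)
      (pre post : List (SMsg (MTerm P.sig (Var P.sig)))) (M : MTerm P.sig (Var P.sig))
      (τ : P.GSubst) : pre ++ .send M :: post ∈ P.strands ro → pre ≠ [] →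
      RespectsFresh τ ro i → inst τ M ∉ IK →
      FStep ⟨⟨ro, i, instL τ pre⟩ ::ₘ SS, IK⟩
        ⟨ro, i, pre.length + 1, .sendLearn (inst τ M), 0⟩
        ⟨⟨ro, i, instL τ (pre ++ [.send M])⟩ ::ₘ SS, insert (inst τ M) IK⟩
  | sendOnly (SS : Multiset (GStrand P)) (IK : Set P.GMes) (ro : P.Role) (i : ℕ)
      (pre post : List (SMsg (MTerm P.sig (Var P.sig)))) (M : MTerm P.sig (Var P.sig))
      (τ : P.GSubst) : pre ++ .send M :: post ∈ P.strands ro → pre ≠ [] →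
      RespectsFresh τ ro i →
      FStep ⟨⟨ro, i, instL τ pre⟩ ::ₘ SS, IK⟩
        ⟨ro, i, pre.length + 1, .sendOnly (inst τ M), 0⟩
        ⟨⟨ro, i, instL τ (pre ++ [.send M])⟩ ::ₘ SS, IK⟩
  | sendLearnNew (SS : Multiset (GStrand P)) (IK : Set P.GMes) (ro : P.Role)
      (post : List (SMsg (MTerm P.sig (Var P.sig)))) (M : MTerm P.sig (Var P.sig))
      (τ : P.GSubst) : .send M :: post ∈ P.strands ro →
      RespectsFresh τ ro (maxStrId SS ro + 1) → inst τ M ∉ IK →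
      FStep ⟨SS, IK⟩ ⟨ro, maxStrId SS ro + 1, 1, .sendLearn (inst τ M), 0⟩
        ⟨⟨ro, maxStrId SS ro + 1, instL τ [.send M]⟩ ::ₘ SS, insert (inst τ M) IK⟩
  | sendOnlyNew (SS : Multiset (GStrand P)) (IK : Set P.GMes) (ro : P.Role)
      (post : List (SMsg (MTerm P.sig (Var P.sig)))) (M : MTerm P.sig (Var P.sig))
      (τ : P.GSubst) : .send M :: post ∈ P.strands ro →
      RespectsFresh τ ro (maxStrId SS ro + 1) →
      FStep ⟨SS, IK⟩ ⟨ro, maxStrId SS ro + 1, 1, .sendOnly (inst τ M), 0⟩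
        ⟨⟨ro, maxStrId SS ro + 1, instL τ [.send M]⟩ ::ₘ SS, IK⟩
  | recv (SS : Multiset (GStrand P)) (IK : Set P.GMes) (ro : P.Role) (i : ℕ)
      (pre post : List (SMsg (MTerm P.sig (Var P.sig)))) (M : MTerm P.sig (Var P.sig))
      (τ : P.GSubst) : pre ++ .recv M :: post ∈ P.strands ro → pre ≠ [] →
      RespectsFresh τ ro i → inst τ M ∈ IK →
      FStep ⟨⟨ro, i, instL τ pre⟩ ::ₘ SS, IK⟩
        ⟨ro, i, pre.length + 1, .recv (inst τ M), 0⟩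
        ⟨⟨ro, i, instL τ (pre ++ [.recv M])⟩ ::ₘ SS, IK⟩
  | recvNew (SS : Multiset (GStrand P)) (IK : Set P.GMes) (ro : P.Role)
      (post : List (SMsg (MTerm P.sig (Var P.sig)))) (M : MTerm P.sig (Var P.sig))
      (τ : P.GSubst) : .recv M :: post ∈ P.strands ro →
      RespectsFresh τ ro (maxStrId SS ro + 1) → inst τ M ∈ IK →
      FStep ⟨SS, IK⟩ ⟨ro, maxStrId SS ro + 1, 1, .recv (inst τ M), 0⟩
        ⟨⟨ro, maxStrId SS ro + 1, instL τ [.recv M]⟩ ::ₘ SS, IK⟩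
  | cond (SS : Multiset (GStrand P)) (IK : Set P.GMes) (ro : P.Role) (i : ℕ)
      (pre post : List (SMsg (MTerm P.sig (Var P.sig)))) (T : Cond (MTerm P.sig (Var P.sig)))
      (n : ℕ) (τ : P.GSubst) : pre ++ .cstr T n :: post ∈ P.strands ro → pre ≠ [] →
      RespectsFresh τ ro i → (T.map (inst τ)).Holds →
      FStep ⟨⟨ro, i, instL τ pre⟩ ::ₘ SS, IK⟩
        ⟨ro, i, pre.length + 1, .cond (testedCond (T.map (inst τ)) n), n⟩
        ⟨⟨ro, i, instL τ (pre ++ [.cstr T n])⟩ ::ₘ SS, IK⟩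
  | nondet (SS : Multiset (GStrand P)) (IK : Set P.GMes) (ro : P.Role) (i : ℕ)
      (pre post : List (SMsg (MTerm P.sig (Var P.sig)))) (n : ℕ) (τ : P.GSubst) :
      pre ++ .nondet n :: post ∈ P.strands ro → pre ≠ [] → RespectsFresh τ ro i →
      FStep ⟨⟨ro, i, instL τ pre⟩ ::ₘ SS, IK⟩ ⟨ro, i, pre.length + 1, .nondet, n⟩
        ⟨⟨ro, i, instL τ (pre ++ [.nondet n])⟩ ::ₘ SS, IK⟩
  | nondetNew (SS : Multiset (GStrand P)) (IK : Set P.GMes) (ro : P.Role)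
      (post : List (SMsg (MTerm P.sig (Var P.sig)))) (n : ℕ) :
      .nondet n :: post ∈ P.strands ro →
      FStep ⟨SS, IK⟩ ⟨ro, maxStrId SS ro + 1, 1, .nondet, n⟩
        ⟨⟨ro, maxStrId SS ro + 1, [.nondet n]⟩ ::ₘ SS, IK⟩

/-- FW-States: the reachable states of the forwards semantics. -/
def IsFWState {P : Protocol} (s : FState P) : Prop :=
  ∃ α, Trace FStep (FState.init P) α s

/-- The relation `H`: reached from the initial states by one and the same label sequence. -/
def RelH {P : Protocol} (p : PState P) (f : FState P) : Prop :=
  IsPAState p ∧ IsFWState f ∧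
    ∃ α, Trace PStep (PState.init P) α p ∧ Trace FStep (FState.init P) α f

/-! ## Symbolic states and the backwards semantics -/

/-- A symbolic strand `:: r₁, …, r_m :: [past | future]`. -/
structure SymStrand (P : Protocol) : Type where
  fresh : Multiset (Term P.sig (Var P.sig))
  past : List (SMsg P.SMes)
  future : List (SMsg P.SMes)

/-- Facts on the intruder knowledge: `m ∈ I`, and `m ∉ I` (not yet known). -/
inductive Fact (α : Type) : Type
  | known (m : α) : Fact α
  | unknown (m : α) : Fact α

def Fact.map {α β : Type} (f : α → β) : Fact α → Fact β
  | .known m => .known (f m)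
  | .unknown m => .unknown (f m)

/-- A constrained symbolic state `⟨S, Ψ⟩`, where `diseqs` is the set `Ψ` of disequalities. Every
state moreover has a variable `SS` for further strands and a variable `IK` for further facts;
since they are always present, they are not recorded. -/
structure CState (P : Protocol) : Type where
  strands : Multiset (SymStrand P)
  facts : Set (Fact P.SMes)
  diseqs : Set (P.SMes × P.SMes)

def SymStrand.subst {P : Protocol} (σ : P.SSubst) (A : SymStrand P) : SymStrand P :=
  ⟨A.fresh.map fun t => t.subst σ, A.past.map (SMsg.map fun m => m.subst σ),
    A.future.map (SMsg.map fun m => m.subst σ)⟩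

/-- `A` is, modulo the equations, an instance of the strand `L` of the specification under `ρ`,
and `A.fresh` lists the images of the fresh variables of `L`. -/
def SymStrand.IsInstance {P : Protocol} (A : SymStrand P)
    (L : List (SMsg (MTerm P.sig (Var P.sig)))) (ρ : P.SSubst) : Prop :=
  A.past ++ A.future = L.map (SMsg.map fun M => (M.subst ρ).cls P.eqs) ∧
    ∃ V : Finset (Var P.sig),
      (∀ x, x ∈ V ↔ x.srt = P.sig.fresh ∧ ∃ u ∈ L, x ∈ u.atoms) ∧ A.fresh = V.val.map ρ.toFun

/-- Constrained symbolic strand states of the protocol: every strand is an instance of a strand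
of the specification, and the fresh entries `r₁, …, r_m` of all the strands are variables of sort
`fresh`, all of them different (every strand generates its own fresh values). -/
structure CState.IsSymbolic {P : Protocol} (C : CState P) : Prop where
  isInstance : ∀ A ∈ C.strands, ∃ ro, ∃ L ∈ P.strands ro, ∃ ρ, A.IsInstance L ρ
  fresh_var : ∀ A ∈ C.strands, ∀ t ∈ A.fresh, ∃ k, t = .var (freshVar P.sig k)
  fresh_nodup : (C.strands.bind SymStrand.fresh).Nodup
  facts_finite : C.facts.Finite
  diseqs_finite : C.diseqs.Finite

/-- Symbolic initial states: the bar is at the beginning of all strands, and no fact is of the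
form `m ∈ I`. -/
def CState.IsInitial {P : Protocol} (C : CState P) : Prop :=
  (∀ A ∈ C.strands, A.past = []) ∧ ∀ m, Fact.known m ∉ C.facts

/-- Satisfiability of a set of disequalities in the algebra of symbolic messages. -/
def Satisfiable {P : Protocol} (Ψ : Set (P.SMes × P.SMes)) : Prop :=
  ∃ σ : P.SSubst, ∀ d ∈ Ψ, d.1.subst σ ≠ d.2.subst σ

/-- The rules of the constrained backwards semantics, applied backwards: in `BackRule C C'` the
state `C` is an instance of the right-hand side of a rule in its forwards form, and `C'` is the
corresponding instance of the left-hand side. -/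
inductive BackRule {P : Protocol} : CState P → CState P → Prop
  | recv (SS : Multiset (SymStrand P)) (IK : Set (Fact P.SMes)) (Ψ : Set (P.SMes × P.SMes))
      (F : Multiset (Term P.sig (Var P.sig))) (L L' : List (SMsg P.SMes)) (M : P.SMes) :
      BackRule ⟨⟨F, L ++ [.recv M], L'⟩ ::ₘ SS, insert (.known M) IK, Ψ⟩
        ⟨⟨F, L, .recv M :: L'⟩ ::ₘ SS, insert (.known M) IK, Ψ⟩
  | sendOnly (SS : Multiset (SymStrand P)) (IK : Set (Fact P.SMes)) (Ψ : Set (P.SMes × P.SMes))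
      (F : Multiset (Term P.sig (Var P.sig))) (L L' : List (SMsg P.SMes)) (M : P.SMes) :
      BackRule ⟨⟨F, L ++ [.send M], L'⟩ ::ₘ SS, IK, Ψ⟩ ⟨⟨F, L, .send M :: L'⟩ ::ₘ SS, IK, Ψ⟩
  | sendLearn (SS : Multiset (SymStrand P)) (IK : Set (Fact P.SMes)) (Ψ : Set (P.SMes × P.SMes))
      (F : Multiset (Term P.sig (Var P.sig))) (L L' : List (SMsg P.SMes)) (M : P.SMes) :
      BackRule ⟨⟨F, L ++ [.send M], L'⟩ ::ₘ SS, insert (.known M) IK, Ψ⟩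
        ⟨⟨F, L, .send M :: L'⟩ ::ₘ SS, insert (.unknown M) IK, Ψ⟩
  | newStrand (SS : Multiset (SymStrand P)) (IK : Set (Fact P.SMes))
      (Ψ : Set (P.SMes × P.SMes)) (ro : P.Role)
      (l₁ l₂ : List (SMsg (MTerm P.sig (Var P.sig)))) (u : MTerm P.sig (Var P.sig))
      (ρ : P.SSubst) (A : SymStrand P) : l₁ ++ .send u :: l₂ ∈ P.strands ro →
      A.IsInstance (l₁ ++ .send u :: l₂) ρ → A.past.length = l₁.length →
      BackRule ⟨SS, insert (.known ((u.subst ρ).cls P.eqs)) IK, Ψ⟩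
        ⟨A ::ₘ SS, insert (.unknown ((u.subst ρ).cls P.eqs)) IK, Ψ⟩
  | nondet (SS : Multiset (SymStrand P)) (IK : Set (Fact P.SMes)) (Ψ : Set (P.SMes × P.SMes))
      (F : Multiset (Term P.sig (Var P.sig))) (L L' : List (SMsg P.SMes)) (n : ℕ) :
      BackRule ⟨⟨F, L ++ [.nondet n], L'⟩ ::ₘ SS, IK, Ψ⟩
        ⟨⟨F, L, .nondet n :: L'⟩ ::ₘ SS, IK, Ψ⟩
  | condEq (SS : Multiset (SymStrand P)) (IK : Set (Fact P.SMes)) (Ψ : Set (P.SMes × P.SMes))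
      (F : Multiset (Term P.sig (Var P.sig))) (L L' : List (SMsg P.SMes)) (M : P.SMes) (n : ℕ) :
      BackRule ⟨⟨F, L ++ [.cstr (.eq M M) n], L'⟩ ::ₘ SS, IK, Ψ⟩
        ⟨⟨F, L, .cstr (.eq M M) n :: L'⟩ ::ₘ SS, IK, Ψ⟩
  | condNeq (SS : Multiset (SymStrand P)) (IK : Set (Fact P.SMes)) (Ψ : Set (P.SMes × P.SMes))
      (F : Multiset (Term P.sig (Var P.sig))) (L L' : List (SMsg P.SMes)) (M M' : P.SMes)
      (n : ℕ) : Satisfiable (insert (M, M') Ψ) →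
      BackRule ⟨⟨F, L ++ [.cstr (.neq M M') n], L'⟩ ::ₘ SS, IK, Ψ⟩
        ⟨⟨F, L, .cstr (.neq M M') n :: L'⟩ ::ₘ SS, IK, insert (M, M') Ψ⟩

/-- A backwards narrowing step from `C` to `C'`, modulo the equations, with unifier `σ`: the
instance of `C` under the unifier is an instance of the right-hand side of a (forwards) rule, and
`C'` is the corresponding instance of its left-hand side. The unifier also binds the variables
`SS` and `IK` of `C`, namely to `SS₁` and `IK₁` together with new variables. Any unifier may be
used, in particular every one from a complete set of unifiers. -/
def Narrow {P : Protocol} (C : CState P) (σ : P.SSubst) (C' : CState P) : Prop :=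
  ∃ (SS₁ : Multiset (SymStrand P)) (IK₁ : Set (Fact P.SMes)),
    BackRule ⟨C.strands.map (SymStrand.subst σ) + SS₁,
      (Fact.map fun m => m.subst σ) '' C.facts ∪ IK₁,
      (Prod.map (fun m => m.subst σ) fun m => m.subst σ) '' C.diseqs⟩ C'

/-- A backwards narrowing sequence from `C` to `C₀`. -/
structure NarrowSeq {P : Protocol} (C C₀ : CState P) : Type where
  len : ℕ
  state : ℕ → CState P
  unif : ℕ → P.SSubst
  first : state 0 = C
  last : state len = C₀
  step : ∀ k < len, Narrow (state k) (unif k) (state (k + 1))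

/-- The composition of `σ k`, …, `σ (k + m - 1)`, in this order. -/
def compFrom {P : Protocol} (σ : ℕ → P.SSubst) : ℕ → ℕ → P.SSubst
  | _, 0 => Subst.id P.sig (Var P.sig)
  | k, m + 1 => (σ k).comp (compFrom σ (k + 1) m)

/-- The composition of the unifiers of the sequence from its `k`-th state on. -/
def NarrowSeq.rest {P : Protocol} {C C₀ : CState P} (N : NarrowSeq C C₀) (k : ℕ) : P.SSubst :=
  compFrom N.unif k (N.len - k)

/-- The lifting relation: `C` instantiates to the ground strand state `s` with `θ`. A strand with
no past element has no counterpart in a ground state, whose strands are introduced together with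
their first element. -/
structure Lifts {P : Protocol} (C : CState P) (θ : P.GSubst) (s : FState P) : Prop where
  strand : ∀ A ∈ C.strands, A.past ≠ [] →
    ∃ g ∈ s.strands, g.msgs = A.past.map (SMsg.map fun m => m.subst θ)
  known : ∀ w, Fact.known w ∈ C.facts → w.subst θ ∈ s.ik
  unknown : ∀ w, Fact.unknown w ∈ C.facts → w.subst θ ∉ s.ik
  diseq : ∀ d ∈ C.diseqs, d.1.subst θ ≠ d.2.subst θ

/-- The ground instance of the narrowing sequence by `θ` respects the facts `m ∉ I` of its first
state `C`: a message not known in `C` is at no state of the sequence among the messages that the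
state requires to be known. -/
def NarrowSeq.Consistent {P : Protocol} {C C₀ : CState P} (N : NarrowSeq C C₀)
    (θ : P.GSubst) : Prop :=
  ∀ k ≤ N.len, ∀ w w', Fact.known w ∈ (N.state k).facts → Fact.unknown w' ∈ C.facts →
    w.subst ((N.rest k).comp θ) ≠ w'.subst ((N.rest 0).comp θ)

end MaudeNPA

open MaudeNPA

namespace MaudeNPA

/-! ## Substitutions -/

/-! A narrowing sequence read from its last state to its first is a forwards run. Every backwards
rule moves one bar back over one element `u` (`BackRule.exists_element`). If the `k`-th state is
instantiated by the composition `N.rest k` of the remaining unifiers, all states speak about the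
strands of `C₀`. So the sequence becomes a list `ms` of strand indices, one entry per executed
element, together with a growing set `K` of known messages (`NarrowSeq.exists_schedule`). Equality
constraints in it have the form `M = M` and hold under every substitution. The disequalities that
are used all lie in `C₀.diseqs`.

The schedule cannot simply be instantiated by `θ`, which may identify fresh variables or send them
to the wrong names. But the fresh entries of `C₀` are pairwise different variables, so there are
`θ'` and `δ` with `θ'.comp δ = θ` such that `θ'` gives every fresh variable its name `r.ro.i`, with
sessions numbered by first occurrence in `ms` (`exists_fresh_names`,
`CState.IsSymbolic.exists_sessions`). An equality under `θ'` implies the same equality under `θ`.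
Hence the disequalities of `C₀`, and the consistency of the unknown facts, pass from `θ` to `θ'`.

Each scheduled element is then executed by both forwards semantics at once, with the same label
(`Executed.step`, `Sessions.Reaches.step`, `Schedule.reaches`). On the process side a choice is
tested only on a ground constraint; well-formedness guarantees that all its variables are bound by
then (`Proc.WF.cstrBound`). The final forwards state lifts `C` by `(N.rest 0).comp θ'`. Its unknown
facts are respected because every message of `K` is a known fact of some state of the sequence. -/

theorem Subst.ext {S : Signature} {X Y : Type} [Sorted S X] [Sorted S Y] {σ τ : Subst S X Y}
    (h : ∀ x, σ.toFun x = τ.toFun x) : σ = τ := by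
  cases σ; cases τ
  congr
  exact funext h

theorem Term.subst_id {S : Signature} {X : Type} [Sorted S X] (t : Term S X) :
    t.subst (Subst.id S X) = t := by
  induction t with
  | var x => rfl
  | app f args ih => exact congrArg (Term.app f) (funext ih)

theorem Term.subst_congr {S : Signature} {X Y : Type} [Sorted S X] [Sorted S Y]
    {t : Term S X} {σ τ : Subst S X Y} (h : ∀ x ∈ t.atoms, σ.toFun x = τ.toFun x) :
    t.subst σ = t.subst τ := by
  induction t with
  | var x => exact h x rfl
  | app f args ih =>
    exact congrArg (Term.app f) (funext fun i => ih i fun x hx => h x (Set.mem_iUnion.2 ⟨i, hx⟩))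

theorem Term.mem_atoms_subst {S : Signature} {X Y : Type} [Sorted S X] [Sorted S Y]
    {t : Term S X} {σ : Subst S X Y} {x : X} {y : Y} (hx : x ∈ t.atoms)
    (hy : y ∈ (σ.toFun x).atoms) : y ∈ (t.subst σ).atoms := by
  induction t with
  | var z => obtain rfl : x = z := hx; exact hy
  | app f args ih =>
    obtain ⟨i, hi⟩ := Set.mem_iUnion.1 hx
    exact Set.mem_iUnion.2 ⟨i, ih i hi⟩

theorem MTerm.subst_comp {S : Signature} {X Y Z : Type} [Sorted S X] [Sorted S Y] [Sorted S Z]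
    (m : MTerm S X) (σ : Subst S X Y) (τ : Subst S Y Z) :
    (m.subst σ).subst τ = m.subst (σ.comp τ) :=
  Subtype.ext (Term.subst_subst m.1 σ τ _ fun _ => rfl)

theorem Message.subst_comp {S : Signature} {E : Set (Term S (Var S) × Term S (Var S))}
    {X Y Z : Type} [Sorted S X] [Sorted S Y] [Sorted S Z] (m : Message E X) (σ : Subst S X Y)
    (τ : Subst S Y Z) : (m.subst σ).subst τ = m.subst (σ.comp τ) := by
  induction m using Quotient.inductionOn with
  | h m => exact congrArg (MTerm.cls E) (MTerm.subst_comp m σ τ)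

theorem Message.subst_id {S : Signature} {E : Set (Term S (Var S) × Term S (Var S))}
    {X : Type} [Sorted S X] (m : Message E X) : m.subst (Subst.id S X) = m := by
  induction m using Quotient.inductionOn with
  | h m => exact congrArg (MTerm.cls E) (Subtype.ext (Term.subst_id m.1))

theorem Subst.comp_assoc {S : Signature} {W X Y Z : Type} [Sorted S W] [Sorted S X] [Sorted S Y]
    [Sorted S Z] (σ : Subst S W X) (τ : Subst S X Y) (υ : Subst S Y Z) :
    (σ.comp τ).comp υ = σ.comp (τ.comp υ) :=
  Subst.ext fun x => Term.subst_subst (σ.toFun x) τ υ _ fun _ => rfl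

/-! ## Maps of strand elements and processes -/

theorem Cond.map_map {α β γ : Type} (g : β → γ) (f : α → β) (T : Cond α) :
    (T.map f).map g = T.map (fun a => g (f a)) := by
  cases T <;> rfl

theorem Cond.neg_neg {α : Type} (T : Cond α) : T.neg.neg = T := by
  cases T <;> rfl

theorem Cond.map_neg {α β : Type} (f : α → β) (T : Cond α) : T.neg.map f = (T.map f).neg := by
  cases T <;> rfl

theorem Cond.holds_neg {α : Type} (T : Cond α) : T.neg.Holds ↔ ¬ T.Holds := by
  cases T <;> simp [Cond.neg, Cond.Holds]

theorem Cond.atoms_neg {S : Signature} {X : Type} [Sorted S X] (T : Cond (MTerm S X)) :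
    T.neg.atoms = T.atoms := by
  cases T <;> rfl

theorem SMsg.map_map {α β γ : Type} (g : β → γ) (f : α → β) (u : SMsg α) :
    (u.map f).map g = u.map (fun a => g (f a)) := by
  cases u <;> simp [SMsg.map, Cond.map_map]

theorem SMsg.map_id' {α : Type} (u : SMsg α) : u.map (fun a => a) = u := by
  rcases u with _ | _ | _ | ⟨_ | _, _⟩ <;> rfl

theorem SMsg.map_congr_atoms {S : Signature} {X β : Type} [Sorted S X] {f g : MTerm S X → β}
    {u : SMsg (MTerm S X)} (h : ∀ m : MTerm S X, m.atoms ⊆ u.atoms → f m = g m) :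
    u.map f = u.map g := by
  rcases u with M | M | n | ⟨a | a, n⟩
  · exact congrArg SMsg.send (h _ subset_rfl)
  · exact congrArg SMsg.recv (h _ subset_rfl)
  · rfl
  · simp only [SMsg.map, Cond.map]
    rw [h _ Set.subset_union_left, h _ Set.subset_union_right]
  · simp only [SMsg.map, Cond.map]
    rw [h _ Set.subset_union_left, h _ Set.subset_union_right]

theorem Proc.map_map {α β γ : Type} (g : β → γ) (f : α → β) (Q : Proc α) :
    (Q.map f).map g = Q.map (fun a => g (f a)) := by
  induction Q <;> simp_all [Proc.map, Cond.map_map]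

theorem Proc.map_seq {α β : Type} (f : α → β) (Q K : Proc α) :
    (Q.seq K).map f = (Q.map f).seq (K.map f) := by
  induction Q <;> simp_all [Proc.map, Proc.seq]

theorem Proc.seq_assoc {α : Type} (Q K R : Proc α) : (Q.seq K).seq R = Q.seq (K.seq R) := by
  induction Q <;> simp_all [Proc.seq]

theorem Proc.seq_nilP {α : Type} (Q : Proc α) : Q.seq .nilP = Q := by
  induction Q <;> simp_all [Proc.seq]

/-! ## Strands of well-formed processes -/

/-- Induction on the derivation: the first action belongs to `Q` unless `Q` is `nilP`. In the
branching cases the continuation is again of the form `_.seq K`, by associativity. -/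
theorem ToStrand.of_seq {α : Type} {Q K : Proc α} {L : List (SMsg α)}
    (h : ToStrand (Q.seq K) L) :
    ∃ L₁ L₂, ToStrand Q L₁ ∧ ToStrand K L₂ ∧ L = L₁ ++ L₂ := by
  generalize hX : Q.seq K = X at h
  induction h generalizing Q with
  | nilP =>
    cases Q with
    | nilP => exact ⟨[], [], .nilP, by rw [show K = .nilP from hX]; exact .nilP, rfl⟩
    | _ => simp [Proc.seq] at hX
  | send M R L hR ih =>
    cases Q with
    | nilP => exact ⟨[], _, .nilP, by rw [show K = _ from hX]; exact .send _ _ _ hR, rfl⟩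
    | send M' Q =>
      simp only [Proc.seq, Proc.send.injEq] at hX
      obtain ⟨L₁, L₂, h₁, h₂, rfl⟩ := ih hX.2
      exact ⟨_, L₂, .send _ _ _ h₁, h₂, by rw [hX.1]; rfl⟩
    | _ => simp [Proc.seq] at hX
  | recv M R L hR ih =>
    cases Q with
    | nilP => exact ⟨[], _, .nilP, by rw [show K = _ from hX]; exact .recv _ _ _ hR, rfl⟩
    | recv M' Q =>
      simp only [Proc.seq, Proc.recv.injEq] at hX
      obtain ⟨L₁, L₂, h₁, h₂, rfl⟩ := ih hX.2
      exact ⟨_, L₂, .recv _ _ _ h₁, h₂, by rw [hX.1]; rfl⟩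
    | _ => simp [Proc.seq] at hX
  | ifThen T Q₁ Q₂ R L hR ih =>
    cases Q with
    | nilP => exact ⟨[], _, .nilP, by rw [show K = _ from hX]; exact .ifThen _ _ _ _ _ hR, rfl⟩
    | ite T' Q₁' Q₂' R' =>
      simp only [Proc.seq, Proc.ite.injEq] at hX
      obtain ⟨rfl, rfl, rfl, rfl⟩ := hX
      obtain ⟨L₁, L₂, h₁, h₂, rfl⟩ := ih (Proc.seq_assoc _ _ _)
      exact ⟨_, L₂, .ifThen _ _ _ _ _ h₁, h₂, rfl⟩
    | _ => simp [Proc.seq] at hX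
  | ifElse T Q₁ Q₂ R L hR ih =>
    cases Q with
    | nilP => exact ⟨[], _, .nilP, by rw [show K = _ from hX]; exact .ifElse _ _ _ _ _ hR, rfl⟩
    | ite T' Q₁' Q₂' R' =>
      simp only [Proc.seq, Proc.ite.injEq] at hX
      obtain ⟨rfl, rfl, rfl, rfl⟩ := hX
      obtain ⟨L₁, L₂, h₁, h₂, rfl⟩ := ih (Proc.seq_assoc _ _ _)
      exact ⟨_, L₂, .ifElse _ _ _ _ _ h₁, h₂, rfl⟩
    | _ => simp [Proc.seq] at hX
  | choice₁ Q₁ Q₂ R L hR ih =>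
    cases Q with
    | nilP => exact ⟨[], _, .nilP, by rw [show K = _ from hX]; exact .choice₁ _ _ _ _ hR, rfl⟩
    | choice Q₁' Q₂' R' =>
      simp only [Proc.seq, Proc.choice.injEq] at hX
      obtain ⟨rfl, rfl, rfl⟩ := hX
      obtain ⟨L₁, L₂, h₁, h₂, rfl⟩ := ih (Proc.seq_assoc _ _ _)
      exact ⟨_, L₂, .choice₁ _ _ _ _ h₁, h₂, rfl⟩
    | _ => simp [Proc.seq] at hX
  | choice₂ Q₁ Q₂ R L hR ih =>
    cases Q with
    | nilP => exact ⟨[], _, .nilP, by rw [show K = _ from hX]; exact .choice₂ _ _ _ _ hR, rfl⟩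
    | choice Q₁' Q₂' R' =>
      simp only [Proc.seq, Proc.choice.injEq] at hX
      obtain ⟨rfl, rfl, rfl⟩ := hX
      obtain ⟨L₁, L₂, h₁, h₂, rfl⟩ := ih (Proc.seq_assoc _ _ _)
      exact ⟨_, L₂, .choice₂ _ _ _ _ h₁, h₂, rfl⟩
    | _ => simp [Proc.seq] at hX

theorem ToStrand.seq {α : Type} {Q K : Proc α} {L₁ L₂ : List (SMsg α)} (h₁ : ToStrand Q L₁)
    (h₂ : ToStrand K L₂) : ToStrand (Q.seq K) (L₁ ++ L₂) := by
  induction h₁ with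
  | nilP => exact h₂
  | send M R L _ ih => exact .send _ _ _ ih
  | recv M R L _ ih => exact .recv _ _ _ ih
  | ifThen T Q₁ Q₂ R L _ ih => exact .ifThen _ _ _ _ _ (by rwa [← Proc.seq_assoc])
  | ifElse T Q₁ Q₂ R L _ ih => exact .ifElse _ _ _ _ _ (by rwa [← Proc.seq_assoc])
  | choice₁ Q₁ Q₂ R L _ ih => exact .choice₁ _ _ _ _ (by rwa [← Proc.seq_assoc])
  | choice₂ Q₁ Q₂ R L _ ih => exact .choice₂ _ _ _ _ (by rwa [← Proc.seq_assoc])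

/-- The atoms of a list of strand elements. -/
def listAtoms {S : Signature} {X : Type} [Sorted S X] (L : List (SMsg (MTerm S X))) : Set X :=
  {x | ∃ u ∈ L, x ∈ u.atoms}

theorem listAtoms_mono {S : Signature} {X : Type} [Sorted S X] {L L' : List (SMsg (MTerm S X))}
    (h : L ⊆ L') : listAtoms L ⊆ listAtoms L' :=
  fun _ ⟨u, hu, hx⟩ => ⟨u, h hu, hx⟩

theorem Proc.shVar_seq {S : Signature} {X : Type} [Sorted S X] (Q K : Proc (MTerm S X)) :
    (Q.seq K).shVar = Q.shVar ∪ K.shVar := by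
  induction Q <;> simp_all [Proc.seq, Proc.shVar, Set.union_assoc]

/-- A shared variable occurs in both branches of every choice, hence on whichever execution path is
taken. -/
theorem ToStrand.shVar_subset {S : Signature} {X : Type} [Sorted S X] {Q : Proc (MTerm S X)}
    {L : List (SMsg (MTerm S X))} (h : ToStrand Q L) : Q.shVar ⊆ listAtoms L := by
  have cons {u : SMsg (MTerm S X)} {L : List (SMsg (MTerm S X))} {A B : Set X}
      (hA : A ⊆ u.atoms) (hB : B ⊆ listAtoms L) : A ∪ B ⊆ listAtoms (u :: L) :=
    Set.union_subset (fun x hx => ⟨u, List.mem_cons_self, hA hx⟩)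
      (hB.trans (listAtoms_mono (List.subset_cons_self _ _)))
  induction h with
  | nilP => exact Set.empty_subset _
  | send M R L _ ih => exact cons subset_rfl ih
  | recv M R L _ ih => exact cons subset_rfl ih
  | ifThen T Q₁ Q₂ R L _ ih =>
    rw [Proc.shVar_seq] at ih
    rw [Proc.shVar, Set.union_assoc]
    exact cons subset_rfl ((Set.union_subset_union_left _ Set.inter_subset_left).trans ih)
  | ifElse T Q₁ Q₂ R L _ ih =>
    rw [Proc.shVar_seq] at ih
    rw [Proc.shVar, Set.union_assoc]
    exact cons (Cond.atoms_neg T).ge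
      ((Set.union_subset_union_left _ Set.inter_subset_right).trans ih)
  | choice₁ Q₁ Q₂ R L _ ih =>
    rw [Proc.shVar_seq] at ih
    exact ((Set.union_subset_union_left _ Set.inter_subset_left).trans ih).trans
      (listAtoms_mono (List.subset_cons_self _ _))
  | choice₂ Q₁ Q₂ R L _ ih =>
    rw [Proc.shVar_seq] at ih
    exact ((Set.union_subset_union_left _ Set.inter_subset_right).trans ih).trans
      (listAtoms_mono (List.subset_cons_self _ _))

/-- Every constraint of the strand comes after a nonempty list of elements in which all its atoms
occur. -/
def CstrBound {S : Signature} {X : Type} [Sorted S X] (L : List (SMsg (MTerm S X))) : Prop :=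
  ∀ pre T n post, L = pre ++ .cstr T n :: post → pre ≠ [] ∧ T.atoms ⊆ listAtoms pre

/-- Inserting an element only enlarges the prefixes of later constraints and leaves those of earlier
ones unchanged, so only the new element has to be checked. -/
theorem CstrBound.insert {S : Signature} {X : Type} [Sorted S X]
    {L₁ L₂ : List (SMsg (MTerm S X))} {u : SMsg (MTerm S X)} (h : CstrBound (L₁ ++ L₂))
    (hu : ∀ T n, u = .cstr T n → L₁ ≠ [] ∧ T.atoms ⊆ listAtoms L₁) :
    CstrBound (L₁ ++ u :: L₂) := by
  intro pre T n post e
  rcases List.append_eq_append_iff.1 e with ⟨M, rfl, hM⟩ | ⟨M, rfl, hM⟩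
  · cases M with
    | nil =>
      simp only [List.nil_append, List.cons.injEq] at hM
      simpa using hu T n hM.1
    | cons v M =>
      simp only [List.cons_append, List.cons.injEq] at hM
      obtain ⟨rfl, rfl⟩ := hM
      obtain ⟨h₁, h₂⟩ := h (L₁ ++ M) T n post (by simp)
      refine ⟨by simp, h₂.trans (listAtoms_mono ?_)⟩
      simp
  · cases M with
    | nil =>
      simp only [List.nil_append, List.cons.injEq] at hM
      simpa using hu T n hM.1.symm
    | cons v M =>
      simp only [List.cons_append, List.cons.injEq] at hM
      obtain ⟨rfl, rfl⟩ := hM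
      exact h pre T n (M ++ L₂) (by simp)

/-- Well-formed processes are built by appending at the end. A strand of the larger process, with
the newly appended element removed, is a strand of a smaller well-formed process, so
`CstrBound.insert` applies. For a conditional, the side conditions `P ≠ .nilP` and `T.atoms ⊆
P.shVar` are exactly what the new constraint needs. -/
theorem Proc.WF.cstrBound {S : Signature} {X : Type} [Sorted S X] {Q : Proc (MTerm S X)}
    (hQ : Q.WF) {L : List (SMsg (MTerm S X))} (h : ToStrand Q L) : CstrBound L := by
  have ne_nil {K : Proc (MTerm S X)} {L : List (SMsg (MTerm S X))} (hK : K ≠ .nilP)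
      (h : ToStrand K L) : L ≠ [] := by
    cases h <;> simp_all
  induction hQ generalizing L with
  | nilP =>
    cases h
    intro pre T n post e
    simp at e
  | send Q M _ _ ih =>
    obtain ⟨L₁, L₂, h₁, h₂, rfl⟩ := h.of_seq
    cases h₂ with
    | send _ _ L h₂ =>
      cases h₂
      exact CstrBound.insert (by simpa using ih h₁) (by simp)
  | recv Q M _ _ ih =>
    obtain ⟨L₁, L₂, h₁, h₂, rfl⟩ := h.of_seq
    cases h₂ with
    | recv _ _ L h₂ =>
      cases h₂
      exact CstrBound.insert (by simpa using ih h₁) (by simp)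
  | ite Q T K R hQ _ hT _ _ ih₁ ih₂ =>
    obtain ⟨L₁, L₂, h₁, h₂, rfl⟩ := h.of_seq
    cases h₂ with
    | ifThen _ _ _ _ L h₂ =>
      rw [Proc.seq_nilP] at h₂
      refine CstrBound.insert (ih₁ (h₁.seq h₂)) fun T' n e => ?_
      cases e
      exact ⟨ne_nil hQ h₁, hT.trans h₁.shVar_subset⟩
    | ifElse _ _ _ _ L h₂ =>
      rw [Proc.seq_nilP] at h₂
      refine CstrBound.insert (ih₂ (h₁.seq h₂)) fun T' n e => ?_
      cases e
      exact ⟨ne_nil hQ h₁, (Cond.atoms_neg T).le.trans (hT.trans h₁.shVar_subset)⟩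
  | choice Q K R _ _ _ ih₁ ih₂ =>
    obtain ⟨L₁, L₂, h₁, h₂, rfl⟩ := h.of_seq
    cases h₂ with
    | choice₁ _ _ _ L h₂ =>
      rw [Proc.seq_nilP] at h₂
      exact CstrBound.insert (ih₁ (h₁.seq h₂)) (by simp)
    | choice₂ _ _ _ L h₂ =>
      rw [Proc.seq_nilP] at h₂
      exact CstrBound.insert (ih₂ (h₁.seq h₂)) (by simp)

theorem Protocol.cstrBound {P : Protocol} {ro : P.Role}
    {L : List (SMsg (MTerm P.sig (Var P.sig)))} (h : L ∈ P.strands ro) : CstrBound L :=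
  (P.proc_wf ro h.1).cstrBound h.2

/-! ## Parallel runs of the forwards semantics and the process algebra -/

/-- The element `u` of a ground strand is executed: the intruder knowledge changes from `IK` to
`IK'`, and the label has the action `a` and the branch `n`. -/
inductive Effect {α : Type} : SMsg α → Set α → Action α → ℕ → Set α → Prop
  | sendLearn (M : α) (IK : Set α) : M ∉ IK → Effect (.send M) IK (.sendLearn M) 0 (insert M IK)
  | sendOnly (M : α) (IK : Set α) : Effect (.send M) IK (.sendOnly M) 0 IK
  | recv (M : α) (IK : Set α) : M ∈ IK → Effect (.recv M) IK (.recv M) 0 IK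
  | nondet (n : ℕ) (IK : Set α) : Effect (.nondet n) IK .nondet n IK
  | cstr (T : Cond α) (n : ℕ) (IK : Set α) : T.Holds →
      Effect (.cstr T n) IK (.cond (testedCond T n)) n IK

theorem Effect.fstep_old {P : Protocol} {ro : P.Role} {i : ℕ}
    {pre post : List (SMsg (MTerm P.sig (Var P.sig)))} {u : SMsg (MTerm P.sig (Var P.sig))}
    {τ : P.GSubst} {IK IK' : Set P.GMes} {a : Action P.GMes} {n : ℕ}
    (hL : pre ++ u :: post ∈ P.strands ro) (hpre : pre ≠ []) (hτ : RespectsFresh τ ro i)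
    (h : Effect (u.map (inst τ)) IK a n IK') (SS : Multiset (GStrand P)) :
    FStep ⟨⟨ro, i, instL τ pre⟩ ::ₘ SS, IK⟩ ⟨ro, i, pre.length + 1, a, n⟩
      ⟨⟨ro, i, instL τ (pre ++ [u])⟩ ::ₘ SS, IK'⟩ := by
  cases u with
  | send M =>
    cases h with
    | sendLearn _ _ h => exact .sendLearn SS IK ro i pre post M τ hL hpre hτ h
    | sendOnly => exact .sendOnly SS IK ro i pre post M τ hL hpre hτ
  | recv M => cases h with | recv _ _ h => exact .recv SS IK ro i pre post M τ hL hpre hτ h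
  | nondet k => cases h; exact .nondet SS IK ro i pre post _ τ hL hpre hτ
  | cstr T k =>
    rcases h with _ | _ | _ | _ | ⟨_, _, _, h⟩
    exact .cond SS IK ro i pre post T _ τ hL hpre hτ h

theorem Effect.fstep_new {P : Protocol} {ro : P.Role} {i : ℕ}
    {post : List (SMsg (MTerm P.sig (Var P.sig)))} {u : SMsg (MTerm P.sig (Var P.sig))}
    {τ : P.GSubst} {IK IK' : Set P.GMes} {a : Action P.GMes} {n : ℕ}
    (hL : u :: post ∈ P.strands ro) (hτ : RespectsFresh τ ro i)
    (h : Effect (u.map (inst τ)) IK a n IK') {SS : Multiset (GStrand P)}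
    (hi : i = maxStrId SS ro + 1) :
    FStep ⟨SS, IK⟩ ⟨ro, i, 1, a, n⟩ ⟨⟨ro, i, instL τ [u]⟩ ::ₘ SS, IK'⟩ := by
  subst hi
  cases u with
  | send M =>
    cases h with
    | sendLearn _ _ h => exact .sendLearnNew SS IK ro post M τ hL hτ h
    | sendOnly => exact .sendOnlyNew SS IK ro post M τ hL hτ
  | recv M => cases h with | recv _ _ h => exact .recvNew SS IK ro post M τ hL hτ h
  | nondet k => cases h; exact .nondetNew SS IK ro post _ hL
  -- No forwards rule starts a strand with a constraint; well-formedness excludes this case.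
  | cstr T k => exact absurd rfl (P.cstrBound hL [] T k post rfl).1

/-- `κ` maps the atoms in `B` to their values under `τ`, and leaves all others unchanged or maps
them to their values. -/
structure Binds {P : Protocol} (τ : P.GSubst)
    (κ : Subst P.sig (Var P.sig) (Var P.sig ⊕ Name P.Role)) (B : Set (Var P.sig)) : Prop where
  or : ∀ x, κ.toFun x = (τ.toFun x).subst (nameSubst P) ∨ κ.toFun x = .var (.inl x)
  bound : ∀ x ∈ B, κ.toFun x = (τ.toFun x).subst (nameSubst P)

theorem Term.nameSubst_groundSubst {P : Protocol} (t : Term P.sig (Name P.Role)) (τ : P.GSubst) :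
    (t.subst (nameSubst P)).subst (groundSubst τ) = t := by
  rw [Term.subst_subst t _ _ (Subst.id _ _) fun _ => rfl, Term.subst_id]

theorem Term.nameSubst_bindSubst {P : Protocol} (t : Term P.sig (Name P.Role)) (M : P.PTerm)
    (τ : P.GSubst) : (t.subst (nameSubst P)).subst (bindSubst M τ) = t.subst (nameSubst P) := by
  refine Term.subst_subst t _ _ _ fun n => ?_
  change _ = (bindSubst M τ).toFun (.inr n)
  simp only [bindSubst]
  split_ifs <;> rfl

/-- An atom already bound by `κ` is ground and is not touched by `groundSubst τ`; one left alone
gets its value from `τ` now. -/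
theorem Binds.gval {P : Protocol} {τ : P.GSubst}
    {κ : Subst P.sig (Var P.sig) (Var P.sig ⊕ Name P.Role)} {B : Set (Var P.sig)}
    (h : Binds τ κ B) (M : MTerm P.sig (Var P.sig)) : gval (M.subst κ) τ = inst τ M := by
  refine congrArg (MTerm.cls P.eqs) (Subtype.ext (Term.subst_subst M.1 κ (groundSubst τ) τ ?_))
  intro x
  rcases h.or x with e | e
  · rw [e, Term.nameSubst_groundSubst]
  · rw [e]; rfl

/-- Sending or receiving `M` binds its remaining atoms: if `κ` leaves an atom of `M` alone, that
atom still occurs in `M.subst κ`, which is where `bindSubst` acts. -/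
theorem Binds.comp {P : Protocol} {τ : P.GSubst}
    {κ : Subst P.sig (Var P.sig) (Var P.sig ⊕ Name P.Role)} {B : Set (Var P.sig)}
    (h : Binds τ κ B) (M : MTerm P.sig (Var P.sig)) :
    Binds τ (κ.comp (bindSubst (M.subst κ) τ)) (B ∪ M.atoms) := by
  have key {x : Var P.sig} (e : κ.toFun x = (τ.toFun x).subst (nameSubst P)) :
      (κ.comp (bindSubst (M.subst κ) τ)).toFun x = (τ.toFun x).subst (nameSubst P) := by
    simp only [Subst.comp]
    rw [e, Term.nameSubst_bindSubst]
  have key' {x : Var P.sig} (e : κ.toFun x = .var (.inl x)) :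
      (κ.comp (bindSubst (M.subst κ) τ)).toFun x =
        (bindSubst (M.subst κ) τ).toFun (.inl x) := by
    simp only [Subst.comp]
    rw [e]; rfl
  constructor
  · intro x
    rcases h.or x with e | e
    · exact .inl (key e)
    · rw [key' e]
      simp only [bindSubst]
      split_ifs
      · exact .inl rfl
      · exact .inr rfl
  · rintro x (hx | hx)
    · exact key (h.bound x hx)
    · rcases h.or x with e | e
      · exact key e
      · rw [key' e]
        simp only [bindSubst]
        rw [if_pos]
        · rfl
        · exact Term.mem_atoms_subst (σ := κ) hx (by rw [e]; rfl)

theorem Binds.mono {P : Protocol} {τ : P.GSubst}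
    {κ : Subst P.sig (Var P.sig) (Var P.sig ⊕ Name P.Role)} {B B' : Set (Var P.sig)}
    (h : Binds τ κ B) (hB : B' ⊆ B) : Binds τ κ B' :=
  ⟨h.or, fun x hx => h.bound x (hB hx)⟩

/-- `ProcStep` evaluates a conditional only on a constraint of the form `Cond.ofGround`; this shows
that a constraint with all atoms bound has that form. -/
theorem Binds.ofGround {P : Protocol} {τ : P.GSubst}
    {κ : Subst P.sig (Var P.sig) (Var P.sig ⊕ Name P.Role)} {B : Set (Var P.sig)}
    (h : Binds τ κ B) {T : Cond (MTerm P.sig (Var P.sig))} (hT : T.atoms ⊆ B) :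
    T.map (fun M => M.subst κ) = Cond.ofGround (T.map fun M => M.subst τ) := by
  have key {M : MTerm P.sig (Var P.sig)} (hM : M.atoms ⊆ B) :
      M.subst κ = (M.subst τ).subst (nameSubst P) := by
    rw [MTerm.subst_comp]
    exact Subtype.ext (Term.subst_congr fun x hx => h.bound x (hM hx))
  cases T with
  | eq a b =>
    exact congrArg₂ Cond.eq (key (Set.subset_union_left.trans hT))
      (key (Set.subset_union_right.trans hT))
  | neq a b =>
    exact congrArg₂ Cond.neq (key (Set.subset_union_left.trans hT))
      (key (Set.subset_union_right.trans hT))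

theorem Cond.gval_map_subst {P : Protocol} (τ : P.GSubst)
    (T : Cond (MTerm P.sig (Var P.sig))) :
    Cond.gval (T.map fun M => M.subst τ) = T.map (inst τ) :=
  Cond.map_map _ _ T

/-- The labeled process `p` has executed the part `pre` of the ground instance by `τ` of the
strand `pre ++ post` in session `i` of role `ro`, and it can go on with `post`. -/
def Executed {P : Protocol} (ro : P.Role) (i : ℕ) (τ : P.GSubst)
    (pre post : List (SMsg (MTerm P.sig (Var P.sig)))) (p : LProc P) : Prop :=
  ∃ Q κ, ToStrand Q post ∧ Binds τ κ (listAtoms pre) ∧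
    p = ⟨ro, i, pre.length + 1, Q.map fun M => M.subst κ⟩

theorem Executed.start {P : Protocol} {ro : P.Role} {i : ℕ} {τ : P.GSubst}
    (hτ : RespectsFresh τ ro i) {L : List (SMsg (MTerm P.sig (Var P.sig)))}
    (hL : L ∈ P.strands ro) :
    Executed ro i τ [] L ⟨ro, i, 1, (P.proc ro).map fun M => M.subst (freshSubst P ro i)⟩ := by
  refine ⟨P.proc ro, freshSubst P ro i, hL.2, ⟨fun x => ?_, ?_⟩, rfl⟩
  · simp only [freshSubst]
    split_ifs with hx
    · left
      obtain ⟨s, k⟩ := x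
      obtain rfl : s = P.sig.fresh := hx
      rw [show τ.toFun ⟨P.sig.fresh, k⟩ = _ from hτ k]
      rfl
    · exact .inr rfl
  · rintro x ⟨u, hu, _⟩
    simp at hu

/-- The process side of the simulation. A message extends `κ` by its atoms; a choice leaves `κ`
unchanged, since the atoms of its constraint are bound by `pre`. The path recorded in `post` decides
which branch the process takes. -/
theorem Executed.step {P : Protocol} {ro : P.Role} {i : ℕ} {τ : P.GSubst}
    {pre post : List (SMsg (MTerm P.sig (Var P.sig)))} {u : SMsg (MTerm P.sig (Var P.sig))}
    {p : LProc P} (hL : pre ++ u :: post ∈ P.strands ro)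
    (hp : Executed ro i τ pre (u :: post) p) {IK IK' : Set P.GMes} {a : Action P.GMes} {n : ℕ}
    (h : Effect (u.map (inst τ)) IK a n IK') :
    ∃ p', Executed ro i τ (pre ++ [u]) post p' ∧
      ProcStep p IK ⟨ro, i, pre.length + 1, a, n⟩ p' IK' := by
  obtain ⟨Q, κ, hQ, hκ, rfl⟩ := hp
  have hmsg {M : MTerm P.sig (Var P.sig)} (hu : u.atoms = M.atoms) :
      Binds τ (κ.comp (bindSubst (M.subst κ) τ)) (listAtoms (pre ++ [u])) := by
    refine (hκ.comp M).mono ?_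
    rintro x ⟨v, hv, hx⟩
    rcases List.mem_append.1 hv with hv | hv
    · exact .inl ⟨v, hv, hx⟩
    · obtain rfl := List.mem_singleton.1 hv
      exact .inr (hu ▸ hx)
  have hcstr (hu : u.atoms ⊆ listAtoms pre) : Binds τ κ (listAtoms (pre ++ [u])) := by
    refine hκ.mono ?_
    rintro x ⟨v, hv, hx⟩
    rcases List.mem_append.1 hv with hv | hv
    · exact ⟨v, hv, hx⟩
    · obtain rfl := List.mem_singleton.1 hv
      exact hu hx
  have hmap (Q : Proc (MTerm P.sig (Var P.sig))) (M : MTerm P.sig (Var P.sig)) :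
      Q.map (fun N => N.subst (κ.comp (bindSubst (M.subst κ) τ))) =
        (Q.map fun N => N.subst κ).map fun N => N.subst (bindSubst (M.subst κ) τ) := by
    rw [Proc.map_map]
    simp only [MTerm.subst_comp]
  have hlen : (pre ++ [u]).length + 1 = pre.length + 1 + 1 := by simp
  cases hQ with
  | send M Q _ hQ =>
    refine ⟨_, ⟨Q, _, hQ, hmsg rfl, rfl⟩, ?_⟩
    rw [hmap, hlen]
    simp only [SMsg.map, ← hκ.gval M] at h
    cases h with
    | sendLearn _ _ h => exact .sendLearn _ _ _ _ _ _ _ h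
    | sendOnly => exact .sendOnly _ _ _ _ _ _ _
  | recv M Q _ hQ =>
    refine ⟨_, ⟨Q, _, hQ, hmsg rfl, rfl⟩, ?_⟩
    rw [hmap, hlen]
    simp only [SMsg.map, ← hκ.gval M] at h
    cases h with
    | recv _ _ h => exact .recv _ _ _ _ _ _ _ h
  | ifThen T Q₁ Q₂ R _ hQ =>
    have hT := (P.cstrBound hL pre T 1 post rfl).2
    refine ⟨_, ⟨_, κ, hQ, hcstr hT, rfl⟩, ?_⟩
    simp only [SMsg.map] at h
    cases h with
    | cstr _ _ _ h =>
    rw [hlen, Proc.map_seq, Proc.map, hκ.ofGround hT, ← Cond.gval_map_subst]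
    rw [← Cond.gval_map_subst] at h
    exact .ifThen _ _ _ _ _ _ _ _ h
  | ifElse T Q₁ Q₂ R _ hQ =>
    have hT := (P.cstrBound hL pre T.neg 2 post rfl).2
    refine ⟨_, ⟨_, κ, hQ, hcstr hT, rfl⟩, ?_⟩
    simp only [SMsg.map] at h
    cases h with
    | cstr _ _ _ h =>
    -- The strand carries `¬T`, while the process tests `T`; `testedCond` undoes the negation, so
    -- both labels show the same constraint.
    rw [Cond.map_neg, Cond.holds_neg, ← Cond.gval_map_subst] at h
    rw [hlen, Proc.map_seq, Proc.map, hκ.ofGround ((Cond.atoms_neg T).ge.trans hT), testedCond,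
      if_pos rfl, Cond.map_neg, Cond.neg_neg, ← Cond.gval_map_subst]
    exact .ifElse _ _ _ _ _ _ _ _ h
  | choice₁ Q₁ Q₂ R _ hQ =>
    refine ⟨_, ⟨_, κ, hQ, hcstr (Set.empty_subset _), rfl⟩, ?_⟩
    cases h
    rw [hlen, Proc.map_seq]
    exact .choice₁ _ _ _ _ _ _ _
  | choice₂ Q₁ Q₂ R _ hQ =>
    refine ⟨_, ⟨_, κ, hQ, hcstr (Set.empty_subset _), rfl⟩, ?_⟩
    cases h
    rw [hlen, Proc.map_seq]
    exact .choice₂ _ _ _ _ _ _ _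

/-- Sessions of a protocol: for each of them a role, an identifier, a strand of the role, and the
ground substitution that instantiates it. -/
structure Sessions (P : Protocol) (ι : Type) : Type where
  role : ι → P.Role
  id : ι → ℕ
  strand : ι → List (SMsg (MTerm P.sig (Var P.sig)))
  val : ι → P.GSubst
  mem : ∀ j, strand j ∈ P.strands (role j)
  fresh : ∀ j, RespectsFresh (val j) (role j) (id j)

/-- The forwards state in which the sessions have executed their strands as often as they occur
in `ms`. -/
def Sessions.fstate {P : Protocol} {ι : Type} [DecidableEq ι] (D : Sessions P ι) (ms : List ι)
    (IK : Set P.GMes) : FState P :=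
  ⟨ms.toFinset.val.map fun j =>
    ⟨D.role j, D.id j, instL (D.val j) ((D.strand j).take (ms.count j))⟩, IK⟩

theorem Sessions.mem_fstate {P : Protocol} {ι : Type} [DecidableEq ι] (D : Sessions P ι)
    {ms : List ι} (IK : Set P.GMes) {j : ι} (hj : j ∈ ms) :
    ⟨D.role j, D.id j, instL (D.val j) ((D.strand j).take (ms.count j))⟩ ∈
      (D.fstate ms IK).strands := by
  rw [fstate]
  exact Multiset.mem_map.2 ⟨j, show j ∈ ms.toFinset.val from List.mem_toFinset.2 hj, rfl⟩

/-- The forwards state for `ms` is reached by a label sequence that the process algebra can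
execute too. -/
def Sessions.Reaches {P : Protocol} {ι : Type} [DecidableEq ι] (D : Sessions P ι) (ms : List ι)
    (IK : Set P.GMes) : Prop :=
  ∃ α, Trace FStep (FState.init P) α (D.fstate ms IK) ∧ ∃ p : ι → LProc P,
    (∀ j ∈ ms, Executed (D.role j) (D.id j) (D.val j) ((D.strand j).take (ms.count j))
      ((D.strand j).drop (ms.count j)) (p j)) ∧
    Trace PStep (PState.init P) α ⟨ms.toFinset.val.map p, IK⟩

theorem Sessions.reaches_nil {P : Protocol} {ι : Type} [DecidableEq ι] (D : Sessions P ι) :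
    D.Reaches [] ∅ :=
  ⟨[], .nil _, fun j => ⟨D.role j, 0, 0, .nilP⟩, by simp, .nil _⟩

theorem Executed.role_id {P : Protocol} {ro : P.Role} {i : ℕ} {τ : P.GSubst}
    {pre post : List (SMsg (MTerm P.sig (Var P.sig)))} {p : LProc P}
    (h : Executed ro i τ pre post p) : (p.role, p.id) = (ro, i) := by
  obtain ⟨Q, κ, _, _, rfl⟩ := h
  rfl

/-- Both traces are extended by one transition with the same label. If `j` already occurs in `ms`,
its strand and its process continue; otherwise both semantics introduce a new session, and `hid`
says that its identifier is the one they prescribe. -/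
theorem Sessions.Reaches.step {P : Protocol} {ι : Type} [DecidableEq ι] {D : Sessions P ι}
    {ms : List ι} {IK IK' : Set P.GMes} (hR : D.Reaches ms IK) {j : ι}
    {pre post : List (SMsg (MTerm P.sig (Var P.sig)))} {u : SMsg (MTerm P.sig (Var P.sig))}
    (hpre : (D.strand j).take (ms.count j) = pre)
    (hpost : (D.strand j).drop (ms.count j) = u :: post) {a : Action P.GMes} {n : ℕ}
    (h : Effect (u.map (inst (D.val j))) IK a n IK')
    (hid : j ∉ ms → D.id j =
      maxId (ms.toFinset.val.map fun i => (D.role i, D.id i)) (D.role j) + 1) :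
    D.Reaches (ms ++ [j]) IK' := by
  obtain ⟨α, hF, p, hp, hP⟩ := hR
  have hmem := D.mem j
  rw [← List.take_append_drop (ms.count j) (D.strand j), hpre, hpost] at hmem
  have hlt : ms.count j < (D.strand j).length := by
    by_contra hge
    rw [List.drop_eq_nil_of_le (not_lt.1 hge)] at hpost
    simp at hpost
  have hlen : pre.length = ms.count j := by
    rw [← hpre, List.length_take]; omega
  have hcount : (ms ++ [j]).count j = ms.count j + 1 := by simp
  have hcount' {i : ι} (hi : i ≠ j) : (ms ++ [j]).count i = ms.count i := by
    simp [List.count_append, Ne.symm hi]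
  have hpre' : (D.strand j).take ((ms ++ [j]).count j) = pre ++ [u] := by
    rw [hcount, List.take_add, hpre, hpost]
    rfl
  have hpost' : (D.strand j).drop ((ms ++ [j]).count j) = post := by
    rw [hcount, ← List.drop_drop, hpost]
    rfl
  -- Erasing `j` first gives one decomposition that serves both for a running and for a new session.
  have hset : (ms ++ [j]).toFinset = insert j (ms.toFinset.erase j) := by
    ext i
    by_cases hi : i = j <;> simp [hi]
  have hcons {β : Type} (g : ι → β) : (ms ++ [j]).toFinset.val.map g =
      g j ::ₘ (ms.toFinset.erase j).val.map g := by
    rw [hset, Finset.insert_val_of_notMem (Finset.notMem_erase _ _), Multiset.map_cons]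
  have hcongr {β : Type} {g g' : ι → β} (e : ∀ i ≠ j, g i = g' i) :
      (ms.toFinset.erase j).val.map g = (ms.toFinset.erase j).val.map g' :=
    Multiset.map_congr rfl fun i hi =>
      e i (Finset.ne_of_mem_erase (show i ∈ ms.toFinset.erase j from hi))
  have hFstate : D.fstate (ms ++ [j]) IK' =
      ⟨⟨D.role j, D.id j, instL (D.val j) (pre ++ [u])⟩ ::ₘ
        (ms.toFinset.erase j).val.map fun i =>
          ⟨D.role i, D.id i, instL (D.val i) ((D.strand i).take (ms.count i))⟩, IK'⟩ := by
    rw [fstate, hcons, hpre', hcongr fun i hi => by rw [hcount' hi]]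
  have hPstate (p' : LProc P) : (ms ++ [j]).toFinset.val.map (Function.update p j p') =
      p' ::ₘ (ms.toFinset.erase j).val.map p := by
    rw [hcons, Function.update_self, hcongr fun i hi => Function.update_of_ne hi p' p]
  have hexec {p' : LProc P} (hp' : Executed (D.role j) (D.id j) (D.val j) (pre ++ [u]) post p') :
      ∀ i ∈ ms ++ [j], Executed (D.role i) (D.id i) (D.val i)
        ((D.strand i).take ((ms ++ [j]).count i)) ((D.strand i).drop ((ms ++ [j]).count i))
        (Function.update p j p' i) := by
    intro i hi
    by_cases hij : i = j
    · subst hij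
      rwa [Function.update_self, hpre', hpost']
    · rw [Function.update_of_ne hij, hcount' hij]
      exact hp i (by simpa [hij] using hi)
  by_cases hj : j ∈ ms
  · have hval {β : Type} (g : ι → β) : ms.toFinset.val.map g =
        g j ::ₘ (ms.toFinset.erase j).val.map g := by
      rw [← Multiset.map_cons, Finset.erase_val,
        Multiset.cons_erase (List.mem_toFinset.2 hj)]
    have hj' := hp j hj
    rw [hpre, hpost] at hj'
    obtain ⟨p', hp', hstep⟩ := hj'.step hmem h
    refine ⟨_, hF.snoc (a := ⟨D.role j, D.id j, pre.length + 1, a, n⟩) ?_,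
      Function.update p j p', hexec hp', hP.snoc ?_⟩
    · rw [hFstate, fstate, hval, hpre]
      refine h.fstep_old hmem ?_ (D.fresh j) _
      rintro rfl
      exact (List.count_pos_iff.2 hj).ne hlen
    · rw [hPstate, hval]
      exact .old _ _ _ _ _ _ hstep
  · obtain rfl : pre = [] := by
      rw [List.count_eq_zero_of_not_mem hj] at hlen
      exact List.length_eq_zero_iff.1 hlen
    have herase : ms.toFinset.erase j = ms.toFinset :=
      Finset.erase_eq_of_notMem (by simpa using hj)
    obtain ⟨p', hp', hstep⟩ := (Executed.start (D.fresh j) hmem).step hmem h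
    refine ⟨_, hF.snoc (a := ⟨D.role j, D.id j, 1, a, n⟩) ?_,
      Function.update p j p', hexec hp', hP.snoc ?_⟩
    · rw [hFstate, herase]
      refine h.fstep_new hmem (D.fresh j) ?_
      rw [hid hj, maxStrId, Multiset.map_map]
      rfl
    · rw [hPstate, herase]
      -- The processes carry the roles and identifiers of their sessions, so both semantics compute
      -- the same maximum.
      have hid' : D.id j = maxProcId (ms.toFinset.val.map p) (D.role j) + 1 := by
        rw [hid hj, maxProcId, Multiset.map_map]
        congr 2
        exact Multiset.map_congr rfl fun i hi =>
          ((hp i (List.mem_toFinset.1 hi)).role_id).symm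
      refine .new _ (D.role j) _ _ _ _ hmem.1 ?_
      rw [← hid']
      exact hstep

/-! ## Backwards narrowing sequences as schedules -/

/-- Every backwards rule moves the bar over one element `u`; what it does to the facts and the
disequalities, and which facts and disequalities it presupposes, depends on `u`. -/
theorem BackRule.exists_element {P : Protocol} {D C : CState P} (h : BackRule D C) :
    ∃ (F : Multiset (Term P.sig (Var P.sig))) (L : List (SMsg P.SMes)) (u : SMsg P.SMes)
      (L' : List (SMsg P.SMes)) (SS : Multiset (SymStrand P)),
      C.strands = ⟨F, L, u :: L'⟩ ::ₘ SS ∧ D.strands ≤ ⟨F, L ++ [u], L'⟩ ::ₘ SS ∧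
      D.diseqs ⊆ C.diseqs ∧
      (∀ w, Fact.known w ∈ D.facts → Fact.known w ∈ C.facts ∨ u = .send w) ∧
      (∀ M, u = .recv M → Fact.known M ∈ C.facts) ∧
      ∀ T n, u = .cstr T n →
        (∃ M, T = .eq M M) ∨ ∃ d ∈ C.diseqs, T = .neq d.1 d.2 := by
  cases h with
  | recv SS IK Ψ F L L' M =>
    exact ⟨F, L, _, L', SS, rfl, le_rfl, subset_rfl, fun _ => .inl,
      fun M' e => by cases e; exact .inl rfl, by simp⟩
  | sendOnly SS IK Ψ F L L' M =>
    exact ⟨F, L, _, L', SS, rfl, le_rfl, subset_rfl, fun _ => .inl, by simp, by simp⟩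
  | sendLearn SS IK Ψ F L L' M =>
    refine ⟨F, L, _, L', SS, rfl, le_rfl, subset_rfl, ?_, by simp, by simp⟩
    rintro w (e | hw)
    · cases e; exact .inr rfl
    · exact .inl (.inr hw)
  | newStrand SS IK Ψ ro l₁ l₂ u ρ A hl hA hlen =>
    have hsplit := hA.1
    rw [List.map_append, List.map_cons] at hsplit
    -- As the past has the length of `l₁`, the future begins with the sent message.
    obtain ⟨-, hfut⟩ := List.append_inj hsplit (by simp [hlen])
    obtain ⟨F, L, L'⟩ := A
    simp only at hfut
    -- The strand is absent from `D`: this is why the strands satisfy only `≤`.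
    refine ⟨F, L, _, _, SS, by rw [hfut], Multiset.le_cons_self _ _, subset_rfl, ?_,
      by simp [SMsg.map], by simp [SMsg.map]⟩
    rintro w (e | hw)
    · cases e; exact .inr rfl
    · exact .inl (.inr hw)
  | nondet SS IK Ψ F L L' n =>
    exact ⟨F, L, _, L', SS, rfl, le_rfl, subset_rfl, fun _ => .inl, by simp, by simp⟩
  | condEq SS IK Ψ F L L' M n =>
    refine ⟨F, L, _, L', SS, rfl, le_rfl, subset_rfl, fun _ => .inl, by simp, ?_⟩
    intro T n e
    cases e
    exact .inl ⟨M, rfl⟩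
  | condNeq SS IK Ψ F L L' M M' n =>
    refine ⟨F, L, _, L', SS, rfl, le_rfl, Set.subset_insert _ _, fun _ => .inl, by simp, ?_⟩
    intro T n e
    cases e
    exact .inr ⟨_, Set.mem_insert _ _, rfl⟩

/-- The pasts and futures of the strands of a state, instantiated. -/
def CState.instStrands {P : Protocol} {Y : Type} [Sorted P.sig Y] (C : CState P)
    (σ : Subst P.sig (Var P.sig) Y) :
    Multiset (List (SMsg (Message P.eqs Y)) × List (SMsg (Message P.eqs Y))) :=
  C.strands.map fun A =>
    (A.past.map (SMsg.map fun m => m.subst σ), A.future.map (SMsg.map fun m => m.subst σ))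

/-- The instances of the messages known in a state. -/
def CState.instKnown {P : Protocol} {Y : Type} [Sorted P.sig Y] (C : CState P)
    (σ : Subst P.sig (Var P.sig) Y) : Set (Message P.eqs Y) :=
  {m | ∃ w, Fact.known w ∈ C.facts ∧ w.subst σ = m}

/-- The instances of the disequalities of a state. -/
def CState.instDiseqs {P : Protocol} {Y : Type} [Sorted P.sig Y] (C : CState P)
    (σ : Subst P.sig (Var P.sig) Y) : Set (Message P.eqs Y × Message P.eqs Y) :=
  (Prod.map (fun m => m.subst σ) fun m => m.subst σ) '' C.diseqs

/-- The element `u` can be executed if the messages in `K` are known and the disequalities in `Ψ`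
are assumed. -/
structure Enabled {α : Type} (Ψ : Set (α × α)) (K : Set α) (u : SMsg α) : Prop where
  recv : ∀ M, u = .recv M → M ∈ K
  cstr : ∀ T n, u = .cstr T n → (∃ M, T = .eq M M) ∨ ∃ d ∈ Ψ, T = .neq d.1 d.2

theorem Enabled.mono {α : Type} {Ψ Ψ' : Set (α × α)} {K K' : Set α} {u : SMsg α}
    (h : Enabled Ψ K u) (hΨ : Ψ ⊆ Ψ') (hK : K ⊆ K') : Enabled Ψ' K' u where
  recv M e := hK (h.recv M e)
  cstr T n e := (h.cstr T n e).imp_right fun ⟨d, hd, e'⟩ => ⟨d, hΨ hd, e'⟩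

/-- Instantiating `C` by `σ.comp μ` and `C'` by `μ` removes the unifier, so the two states can be
compared directly. The additional strands and facts bound to the variables of `C` are absorbed by
the inequality and the inclusions. -/
theorem Narrow.exists_element {P : Protocol} {C C' : CState P} {σ : P.SSubst}
    (h : Narrow C σ C') (μ : P.SSubst) :
    ∃ L u L' SS, C'.instStrands μ = (L, u :: L') ::ₘ SS ∧
      C.instStrands (σ.comp μ) ≤ (L ++ [u], L') ::ₘ SS ∧
      C.instDiseqs (σ.comp μ) ⊆ C'.instDiseqs μ ∧
      (∀ m ∈ C.instKnown (σ.comp μ), m ∈ C'.instKnown μ ∨ u = .send m) ∧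
      Enabled (C'.instDiseqs μ) (C'.instKnown μ) u := by
  obtain ⟨SS₁, IK₁, h⟩ := h
  obtain ⟨F, L, u, L', SS, hC', hC, hΨ, hK, hrecv, hcstr⟩ := h.exists_element
  refine ⟨L.map (SMsg.map fun m => m.subst μ), u.map fun m => m.subst μ,
    L'.map (SMsg.map fun m => m.subst μ), SS.map fun A =>
      (A.past.map (SMsg.map fun m => m.subst μ), A.future.map (SMsg.map fun m => m.subst μ)),
    ?_, ?_, ?_, ?_, ?_, ?_⟩
  · rw [CState.instStrands, hC', Multiset.map_cons]
    rfl
  · have hle := Multiset.map_le_map (f := fun A : SymStrand P =>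
      (A.past.map (SMsg.map fun m => m.subst μ), A.future.map (SMsg.map fun m => m.subst μ)))
      ((Multiset.le_add_right _ _).trans hC)
    rw [Multiset.map_cons, Multiset.map_map] at hle
    simp only [Function.comp_def, SymStrand.subst, List.map_map, List.map_append,
      List.map_cons, List.map_nil, SMsg.map_map, Message.subst_comp] at hle
    exact hle
  · rintro _ ⟨d, hd, rfl⟩
    refine ⟨_, hΨ ⟨d, hd, rfl⟩, ?_⟩
    simp only [Prod.map, Message.subst_comp]
  · rintro _ ⟨w, hw, rfl⟩
    rw [← Message.subst_comp]
    rcases hK (w.subst σ) (.inl ⟨_, hw, rfl⟩) with hw | rfl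
    · exact .inl ⟨_, hw, rfl⟩
    · exact .inr rfl
  · intro M e
    cases u with
    | recv M' =>
      cases e
      exact ⟨M', hrecv M' rfl, rfl⟩
    | _ => simp [SMsg.map] at e
  · intro T n e
    cases u with
    | cstr T' n' =>
      cases e
      rcases hcstr T' _ rfl with ⟨M, rfl⟩ | ⟨d, hd, rfl⟩
      · exact .inl ⟨_, rfl⟩
      · exact .inr ⟨_, ⟨d, hd, rfl⟩, rfl⟩
    | _ => simp [SMsg.map] at e

theorem NarrowSeq.rest_eq_comp {P : Protocol} {C C₀ : CState P} (N : NarrowSeq C C₀) {k : ℕ}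
    (hk : k < N.len) : N.rest k = (N.unif k).comp (N.rest (k + 1)) := by
  obtain ⟨d, hd⟩ := Nat.exists_eq_add_of_lt hk
  rw [rest, rest, show N.len - k = d + 1 by omega, show N.len - (k + 1) = d by omega]
  rfl

theorem NarrowSeq.rest_len {P : Protocol} {C C₀ : CState P} (N : NarrowSeq C C₀) :
    N.rest N.len = Subst.id _ _ := by
  rw [rest, Nat.sub_self]
  rfl

/-- `Schedule full Ψ ms K`: the strands `full j` can be executed in the order given by `ms`, where
all received messages have been sent before, and `K` holds sent messages. -/
inductive Schedule {α ι : Type} [DecidableEq ι] (full : ι → List (SMsg α)) (Ψ : Set (α × α)) :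
    List ι → Set α → Prop
  | nil : Schedule full Ψ [] ∅
  | snoc {ms : List ι} {K : Set α} (j : ι) (u : SMsg α) (L' : List (SMsg α)) (K' : Set α) :
      Schedule full Ψ ms K → (full j).drop (ms.count j) = u :: L' → Enabled Ψ K u → K ⊆ K' →
      (∀ m ∈ K', m ∈ K ∨ u = .send m) → Schedule full Ψ (ms ++ [j]) K'

/-- The positions of the bars after the execution of a schedule. -/
def scheduled {α ι : Type} [Fintype ι] [DecidableEq ι] (full : ι → List (SMsg α)) (ms : List ι) :
    Multiset (List (SMsg α) × List (SMsg α)) :=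
  Finset.univ.val.map fun j => ((full j).take (ms.count j), (full j).drop (ms.count j))

/-- Any index `j` with the bar position `(L, u :: L')` will do: after cancelling its entry, the
other positions are the same before and after the step. -/
theorem exists_scheduled_snoc {α ι : Type} [Fintype ι] [DecidableEq ι]
    {full : ι → List (SMsg α)} {ms : List ι} {L L' : List (SMsg α)} {u : SMsg α}
    {SS : Multiset (List (SMsg α) × List (SMsg α))}
    (h : (L, u :: L') ::ₘ SS ≤ scheduled full ms) :
    ∃ j, (full j).drop (ms.count j) = u :: L' ∧
      (L ++ [u], L') ::ₘ SS ≤ scheduled full (ms ++ [j]) := by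
  obtain ⟨j, -, hj⟩ := Multiset.mem_map.1 (Multiset.mem_of_le h (Multiset.mem_cons_self _ _))
  obtain ⟨hL, hL'⟩ := Prod.mk.inj hj
  have hval {β : Type} (g : ι → β) : Finset.univ.val.map g =
      g j ::ₘ (Finset.univ.erase j).val.map g := by
    rw [← Multiset.map_cons, Finset.erase_val, Multiset.cons_erase (Finset.mem_univ j)]
  refine ⟨j, hL', ?_⟩
  rw [scheduled, hval] at h ⊢
  rw [hj, Multiset.cons_le_cons_iff] at h
  have hcount : (ms ++ [j]).count j = ms.count j + 1 := by simp
  rw [hcount, List.take_add, ← List.drop_drop, hL, hL']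
  refine (Multiset.cons_le_cons_iff _).2 (h.trans_eq (Multiset.map_congr rfl fun i hi => ?_))
  have hij : i ≠ j := Finset.ne_of_mem_erase (show i ∈ Finset.univ.erase j from hi)
  simp [List.count_append, hij.symm]

/-- Induction on the distance from the last state, each narrowing step appending one entry to `ms`.
The last clause traces every message of `K` to a known fact of some state, as is needed for the
facts `m ∉ I`. -/
theorem NarrowSeq.exists_schedule {P : Protocol} {C C₀ : CState P} (N : NarrowSeq C C₀)
    (hinit : C₀.IsInitial) {ι : Type} [Fintype ι] [DecidableEq ι] {A : ι → SymStrand P}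
    (hA : C₀.strands = Finset.univ.val.map A) :
    ∃ ms K, Schedule (fun j => (A j).future) C₀.diseqs ms K ∧
      C.instStrands (N.rest 0) ≤ scheduled (fun j => (A j).future) ms ∧
      C.instDiseqs (N.rest 0) ⊆ C₀.diseqs ∧ C.instKnown (N.rest 0) ⊆ K ∧
      ∀ m ∈ K, ∃ k ≤ N.len, m ∈ (N.state k).instKnown (N.rest k) := by
  suffices H : ∀ d k, k + d = N.len →
      ∃ ms K, Schedule (fun j => (A j).future) C₀.diseqs ms K ∧
        (N.state k).instStrands (N.rest k) ≤ scheduled (fun j => (A j).future) ms ∧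
        (N.state k).instDiseqs (N.rest k) ⊆ C₀.diseqs ∧
        (N.state k).instKnown (N.rest k) ⊆ K ∧
        ∀ m ∈ K, ∃ k ≤ N.len, m ∈ (N.state k).instKnown (N.rest k) by
    have := H N.len 0 (zero_add _)
    rwa [N.first] at this
  intro d
  induction d with
  | zero =>
    rintro k rfl
    refine ⟨[], ∅, .nil, ?_, ?_, ?_, by simp⟩
    · rw [N.last, N.rest_len, CState.instStrands, hA, Multiset.map_map, scheduled]
      refine (Multiset.map_congr rfl fun j _ => ?_).le
      have hp : (A j).past = [] := hinit.1 _ (hA ▸ Multiset.mem_map_of_mem A (Finset.mem_univ j))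
      have hid : (SMsg.map fun m : P.SMes => m) = id := funext SMsg.map_id'
      simp [hp, Message.subst_id, hid]
    · rintro _ ⟨d, hd, rfl⟩
      rw [N.last] at hd
      simpa only [N.rest_len, Message.subst_id, Prod.map, Prod.mk.eta] using hd
    · rintro _ ⟨w, hw, rfl⟩
      rw [N.last] at hw
      exact absurd hw (hinit.2 w)
  | succ d ih =>
    intro k hk
    obtain ⟨ms, K, hS, hstr, hΨ, hK, hK'⟩ := ih (k + 1) (by omega)
    obtain ⟨L, u, L', SS, h₁, h₂, h₃, h₄, h₅⟩ :=
      (N.step k (by omega)).exists_element (N.rest (k + 1))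
    rw [← N.rest_eq_comp (by omega)] at h₂ h₃ h₄
    rw [h₁] at hstr
    obtain ⟨j, hj, hle⟩ := exists_scheduled_snoc hstr
    -- Known facts of state `k + 1` may have been matched by the variable `IK` and be absent from
    -- state `k`. The union keeps knowledge increasing.
    refine ⟨ms ++ [j], K ∪ (N.state k).instKnown (N.rest k),
      .snoc j u L' _ hS hj (h₅.mono hΨ hK) Set.subset_union_left ?_, h₂.trans hle, h₃.trans hΨ,
      Set.subset_union_right, ?_⟩
    · rintro m (hm | hm)
      · exact .inl hm
      · exact (h₄ m hm).imp_left fun h => hK h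
    · rintro m (hm | hm)
      · exact hK' m hm
      · exact ⟨k, by omega, hm⟩

/-! ## Ground schedules -/

/-- The action is chosen after instantiation, because `f` may identify messages: a message learnt
symbolically may already be known as `f M`, and then it is sent without being learnt. -/
theorem Enabled.exists_effect {α β : Type} {Ψ : Set (α × α)} {K K' : Set α} {u : SMsg α}
    (h : Enabled Ψ K u) (hK : K ⊆ K') (hK' : ∀ m ∈ K', m ∈ K ∨ u = .send m) {f : α → β}
    (hf : ∀ d ∈ Ψ, f d.1 ≠ f d.2) : ∃ a n, Effect (u.map f) (f '' K) a n (f '' K') := by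
  have hsame (h : ∀ m ∈ K', f m ∈ f '' K) : f '' K' = f '' K :=
    Set.Subset.antisymm (Set.image_subset_iff.2 h) (Set.image_mono hK)
  cases u with
  | send M =>
    by_cases hM : f M ∈ f '' K
    · rw [hsame fun m hm => (hK' m hm).elim (Set.mem_image_of_mem f) fun e => by cases e; exact hM]
      exact ⟨_, _, .sendOnly _ _⟩
    · by_cases hM' : M ∈ K'
      · have e : f '' K' = insert (f M) (f '' K) := by
          rw [← Set.image_insert_eq]
          congr 1
          ext m
          constructor
          · exact fun hm => (hK' m hm).elim .inr fun e => by cases e; exact .inl rfl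
          · rintro (rfl | hm)
            · exact hM'
            · exact hK hm
        rw [e]
        exact ⟨_, _, .sendLearn _ _ hM⟩
      · rw [hsame fun m hm => (hK' m hm).elim (Set.mem_image_of_mem f) fun e => by
          cases e; exact absurd hm hM']
        exact ⟨_, _, .sendOnly _ _⟩
  | recv M =>
    rw [hsame fun m hm => (hK' m hm).elim (Set.mem_image_of_mem f) (by simp)]
    exact ⟨_, _, .recv _ _ (Set.mem_image_of_mem f (h.recv M rfl))⟩
  | nondet n =>
    rw [hsame fun m hm => (hK' m hm).elim (Set.mem_image_of_mem f) (by simp)]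
    exact ⟨_, _, .nondet _ _⟩
  | cstr T n =>
    rw [hsame fun m hm => (hK' m hm).elim (Set.mem_image_of_mem f) (by simp)]
    refine ⟨_, _, .cstr _ _ _ ?_⟩
    rcases h.cstr T n rfl with ⟨M, rfl⟩ | ⟨d, hd, rfl⟩
    · exact rfl
    · exact hf d hd

/-- `ms` is kept as a prefix of the complete schedule `ms'`, since the session identifiers are fixed
by `ms'`. -/
theorem Schedule.reaches {P : Protocol} {ι : Type} [DecidableEq ι] {D : Sessions P ι}
    {full : ι → List (SMsg P.SMes)} {θ : P.GSubst}
    (hD : ∀ j, instL (D.val j) (D.strand j) = (full j).map (SMsg.map fun m => m.subst θ))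
    {Ψ : Set (P.SMes × P.SMes)} (hΨ : ∀ d ∈ Ψ, d.1.subst θ ≠ d.2.subst θ) {ms ms' : List ι}
    {K : Set P.SMes} (h : Schedule full Ψ ms K) (hms : ms <+: ms')
    (hid : ∀ ms j, ms ++ [j] <+: ms' → j ∉ ms → D.id j =
      maxId (ms.toFinset.val.map fun i => (D.role i, D.id i)) (D.role j) + 1) :
    D.Reaches ms ((fun m => m.subst θ) '' K) := by
  induction h with
  | nil => simpa using D.reaches_nil
  | @snoc ms K j u L' K' _ hj hu hK hK' ih =>
    obtain ⟨a, n, he⟩ := hu.exists_effect hK hK' (f := fun m : P.SMes => m.subst θ) hΨ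
    have hdrop := congrArg (List.drop (ms.count j)) (hD j)
    rw [instL, ← List.map_drop, ← List.map_drop, hj, List.map_cons] at hdrop
    obtain ⟨v, post, hv, hvu, -⟩ := List.map_eq_cons_iff.1 hdrop
    rw [← hvu] at he
    exact (ih ((List.prefix_append _ _).trans hms)).step rfl hv he (hid ms j hms)

/-! ## Session identifiers -/

/-- The number of the session `j` among those of its role, when the sessions start in the order
in which they occur in `ms`. -/
noncomputable def sessionId {Role ι : Type} [DecidableEq Role] [Fintype ι] [DecidableEq ι]
    (role : ι → Role) (ms : List ι) (j : ι) : ℕ :=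
  (Finset.univ.filter fun i => role i = role j ∧
    (ms ++ Finset.univ.toList).idxOf i < (ms ++ Finset.univ.toList).idxOf j).card + 1

theorem sessionId_le {Role ι : Type} [DecidableEq Role] [Fintype ι] [DecidableEq ι]
    (role : ι → Role) (ms : List ι) (j : ι) : sessionId role ms j ≤ Fintype.card ι + 1 :=
  Nat.succ_le_succ (Finset.card_le_univ _)

/-- Since all sessions are appended to `ms`, each has a first position, even one that never starts,
and different sessions have different positions. -/
theorem sessionId_injective {Role ι : Type} [DecidableEq Role] [Fintype ι] [DecidableEq ι]
    {role : ι → Role} {ms : List ι} {j j' : ι} (hr : role j = role j')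
    (h : sessionId role ms j = sessionId role ms j') : j = j' := by
  by_contra hne
  have key {j j' : ι} (hr : role j = role j')
      (hlt : (ms ++ Finset.univ.toList).idxOf j < (ms ++ Finset.univ.toList).idxOf j') :
      sessionId role ms j < sessionId role ms j' := by
    refine Nat.succ_lt_succ (Finset.card_lt_card ⟨?_, fun hsub => ?_⟩)
    · intro i hi
      simp only [Finset.mem_filter, Finset.mem_univ, true_and] at hi ⊢
      exact ⟨hi.1.trans hr, hi.2.trans hlt⟩
    · have hj := hsub (Finset.mem_filter.2 ⟨Finset.mem_univ j, hr, hlt⟩)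
      simp at hj
  have hidx : (ms ++ Finset.univ.toList).idxOf j ≠ (ms ++ Finset.univ.toList).idxOf j' :=
    fun e => hne ((List.idxOf_inj (by simp)).1 e)
  rcases hidx.lt_or_gt with hlt | hlt
  · exact (key hr hlt).ne h
  · exact (key hr.symm hlt).ne h.symm

theorem sessionId_of_prefix {Role ι : Type} [DecidableEq Role] [Fintype ι] [DecidableEq ι]
    (role : ι → Role) {ms ms' : List ι} {j : ι} (h : ms ++ [j] <+: ms') (hj : j ∉ ms) :
    sessionId role ms' j = (ms.toFinset.filter fun i => role i = role j).card + 1 := by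
  obtain ⟨t, rfl⟩ := h
  have hidx : (ms ++ [j] ++ t ++ Finset.univ.toList).idxOf j = ms.length := by
    rw [List.append_assoc, List.append_assoc, List.idxOf_append_of_notMem hj]
    simp
  rw [sessionId, hidx]
  congr 2
  ext i
  simp only [Finset.mem_filter, Finset.mem_univ, true_and, List.mem_toFinset]
  rw [and_comm, List.append_assoc, List.append_assoc]
  refine and_congr_left fun _ => ⟨fun hlt => ?_, fun hi => ?_⟩
  · by_contra hi
    rw [List.idxOf_append_of_notMem hi] at hlt
    omega
  · rw [List.idxOf_append_of_mem hi]
    exact List.idxOf_lt_length_of_mem hi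

open Classical in
theorem maxId_cons {Role : Type} (p : Role × ℕ) (s : Multiset (Role × ℕ))
    (r : Role) : maxId (p ::ₘ s) r = if p.1 = r then max p.2 (maxId s r) else maxId s r := by
  unfold maxId
  split_ifs with h
  · rw [Multiset.filter_cons_of_pos _ (p := fun p : Role × ℕ => p.1 = r) h, Multiset.map_cons,
      Multiset.sup_cons]
  · rw [Multiset.filter_cons_of_neg _ (p := fun p : Role × ℕ => p.1 = r) h]

/-- Within a role the started sessions are numbered `1, 2, …` in order of their start, so the
largest number is their count. -/
theorem maxId_sessionId {Role ι : Type} [DecidableEq Role] [Fintype ι] [DecidableEq ι]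
    (role : ι → Role) {ms ms' : List ι} (h : ms <+: ms') (r : Role) :
    maxId (ms.toFinset.val.map fun i => (role i, sessionId role ms' i)) r =
      (ms.toFinset.filter fun i => role i = r).card := by
  induction ms using List.reverseRecOn with
  | nil => simp [maxId]
  | append_singleton ms j ih =>
    have ih := ih ((List.prefix_append _ _).trans h)
    have hset : (ms ++ [j]).toFinset = insert j ms.toFinset := by
      ext i; simp
    by_cases hj : j ∈ ms
    · rw [hset, Finset.insert_eq_of_mem (List.mem_toFinset.2 hj), ih]
    · have hj' : j ∉ ms.toFinset := by simpa using hj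
      rw [hset, Finset.insert_val_of_notMem hj', Multiset.map_cons, maxId_cons, ih,
        sessionId_of_prefix role h hj, Finset.filter_insert]
      simp only
      split_ifs with hr
      · rw [Finset.card_insert_of_notMem (by simp [hj]), hr, max_eq_left (Nat.le_succ _)]
      · rfl

/-! ## Fresh names -/

/-- A ground substitution can be made more general, so that it maps given fresh variables to given
names, all different. -/
theorem exists_fresh_names {P : Protocol} (θ : P.GSubst) {κ : Type} {v : κ → ℕ}
    {nm : κ → Name P.Role} (hv : Function.Injective v) (hnm : Function.Injective nm) {B : ℕ}
    (hB : ∀ p, (nm p).session < B) :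
    ∃ (θ' : P.GSubst) (δ : Subst P.sig (Name P.Role) (Name P.Role)),
      (∀ p, θ'.toFun (freshVar P.sig (v p)) = .var (nm p)) ∧ θ'.comp δ = θ := by
  classical
  -- Shifting sessions by `B` keeps the names in the values of `θ` apart from all `nm p`.
  let η : Subst P.sig (Name P.Role) (Name P.Role) :=
    ⟨fun n => .var ⟨n.idx, n.role, n.session + B⟩, fun n => .var _ _ le_rfl⟩
  let θ' : P.GSubst :=
    ⟨fun x => if h : ∃ p, freshVar P.sig (v p) = x then .var (nm h.choose)
      else (θ.toFun x).subst η, fun x => by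
        split_ifs with h
        · obtain ⟨p, rfl⟩ := h
          exact .var _ _ le_rfl
        · exact (θ.sorted x).subst η⟩
  -- `δ` sends each `nm p` to the original value of its fresh variable and undoes the shift on other
  -- names. It is consistent since `nm` is injective.
  let δ : Subst P.sig (Name P.Role) (Name P.Role) :=
    ⟨fun n => if h : ∃ p, nm p = n then θ.toFun (freshVar P.sig (v h.choose))
      else .var ⟨n.idx, n.role, n.session - B⟩, fun n => by
        split_ifs with h
        · exact θ.sorted (freshVar P.sig (v h.choose))
        · exact .var _ _ le_rfl⟩
  have hθ' (p : κ) : θ'.toFun (freshVar P.sig (v p)) = .var (nm p) := by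
    have h : ∃ q, freshVar P.sig (v q) = freshVar P.sig (v p) := ⟨p, rfl⟩
    have hp : h.choose = p := hv (congrArg Var.idx h.choose_spec)
    simp only [θ']
    rw [dif_pos h, hp]
  have hδ (p : κ) : δ.toFun (nm p) = θ.toFun (freshVar P.sig (v p)) := by
    have h : ∃ q, nm q = nm p := ⟨p, rfl⟩
    have hp : h.choose = p := hnm h.choose_spec
    simp only [δ]
    rw [dif_pos h, hp]
  refine ⟨θ', δ, hθ', Subst.ext fun x => ?_⟩
  change (θ'.toFun x).subst δ = θ.toFun x
  by_cases h : ∃ p, freshVar P.sig (v p) = x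
  · obtain ⟨p, rfl⟩ := h
    rw [hθ']
    exact hδ p
  · have e : θ'.toFun x = (θ.toFun x).subst η := dif_neg h
    rw [e, Term.subst_subst _ η δ (Subst.id _ _), Term.subst_id]
    intro n
    have hn : ¬ ∃ p, nm p = ⟨n.idx, n.role, n.session + B⟩ := by
      rintro ⟨p, hp⟩
      have := hB p
      rw [hp] at this
      simp at this
    refine Eq.trans ?_ (dif_neg hn).symm
    simp [Subst.id]

open Classical in
/-- The ground substitution `ρ θ`, with the fresh substitution `r ↦ r.ro.i` for the fresh
variables. -/
noncomputable def sessionSubst {P : Protocol} (ro : P.Role) (i : ℕ) (ρ : P.SSubst)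
    (θ : P.GSubst) : P.GSubst where
  toFun x := if x.srt = P.sig.fresh then .var ⟨x.idx, ro, i⟩ else (ρ.comp θ).toFun x
  sorted x := by
    by_cases h : x.srt = P.sig.fresh
    · rw [if_pos h]; exact .var _ _ (le_of_eq h.symm)
    · rw [if_neg h]; exact (ρ.comp θ).sorted x

theorem respectsFresh_sessionSubst {P : Protocol} (ro : P.Role) (i : ℕ) (ρ : P.SSubst)
    (θ : P.GSubst) : RespectsFresh (sessionSubst ro i ρ θ) ro i :=
  fun _ => if_pos rfl

/-- On the atoms of `L` the two substitutions agree. Fresh variables outside `L` are overwritten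
only because `RespectsFresh` concerns all of them. -/
theorem instL_sessionSubst {P : Protocol} {ro : P.Role} {i : ℕ} {ρ : P.SSubst} {θ : P.GSubst}
    {L : List (SMsg (MTerm P.sig (Var P.sig)))}
    (h : ∀ x, x.srt = P.sig.fresh → (∃ u ∈ L, x ∈ u.atoms) →
      (ρ.comp θ).toFun x = .var ⟨x.idx, ro, i⟩) :
    instL (sessionSubst ro i ρ θ) L =
      (L.map (SMsg.map fun M => (M.subst ρ).cls P.eqs)).map (SMsg.map fun m => m.subst θ) := by
  rw [instL, List.map_map]
  refine List.map_congr_left fun u hu => ?_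
  rw [Function.comp_apply, SMsg.map_map]
  refine SMsg.map_congr_atoms fun M hM => congrArg (MTerm.cls P.eqs) ?_
  simp only [MTerm.subst_comp]
  refine Subtype.ext (Term.subst_congr fun x hx => ?_)
  simp only [sessionSubst]
  split_ifs with hs
  · exact (h x hs ⟨u, hu, hM hx⟩).symm
  · rfl

/-! ## Soundness -/

/-- A ground substitution `θ` can be made more general, so that the strands of a symbolic state
become ground strands of sessions whose identifiers follow the order `ms`. -/
theorem CState.IsSymbolic.exists_sessions {P : Protocol} {C : CState P} (hC : C.IsSymbolic)
    {ι : Type} [Fintype ι] [DecidableEq ι] {A : ι → SymStrand P}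
    (hA : C.strands = Finset.univ.val.map A) (θ : P.GSubst) (ms : List ι) :
    ∃ (D : Sessions P ι) (θ' : P.GSubst) (δ : Subst P.sig (Name P.Role) (Name P.Role)),
      θ'.comp δ = θ ∧
      (∀ j, instL (D.val j) (D.strand j) =
        ((A j).past ++ (A j).future).map (SMsg.map fun m => m.subst θ')) ∧
      ∀ ms₀ j, ms₀ ++ [j] <+: ms → j ∉ ms₀ → D.id j =
        maxId (ms₀.toFinset.val.map fun i => (D.role i, D.id i)) (D.role j) + 1 := by
  classical
  have hmem (j : ι) : A j ∈ C.strands := hA ▸ Multiset.mem_map_of_mem A (Finset.mem_univ j)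
  choose ro L hL ρ hinst V hV hfresh using fun j => hC.isInstance (A j) (hmem j)
  have hvar (p : {p : ι × Var P.sig // p.2 ∈ V p.1}) :
      ∃ k, (ρ p.1.1).toFun p.1.2 = .var (freshVar P.sig k) :=
    hC.fresh_var _ (hmem p.1.1) _ (hfresh p.1.1 ▸ Multiset.mem_map_of_mem _ p.2)
  choose v hv using hvar
  have hnodup := hC.fresh_nodup
  rw [hA, Multiset.bind_map, Multiset.nodup_bind] at hnodup
  -- Different strands have disjoint fresh entries, and within one strand the entries have no
  -- repetition.
  have hvinj : Function.Injective v := by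
    rintro ⟨⟨j, x⟩, hx⟩ ⟨⟨j', x'⟩, hx'⟩ e
    have e' : (ρ j).toFun x = (ρ j').toFun x' := by
      rw [hv ⟨⟨j, x⟩, hx⟩, hv ⟨⟨j', x'⟩, hx'⟩, e]
    have hj : j = j' := by
      by_contra hne
      have hdisj := hnodup.2.forall (Finset.mem_univ_val j)
        (Finset.mem_univ_val j') hne
      refine Multiset.disjoint_left.1 hdisj (?_ : (ρ j).toFun x ∈ _) ?_
      · change _ ∈ (A j).fresh; rw [hfresh]; exact Multiset.mem_map_of_mem _ hx
      · change _ ∈ (A j').fresh; rw [hfresh, e']; exact Multiset.mem_map_of_mem _ hx'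
    subst hj
    have hn := hnodup.1 j (Finset.mem_univ_val j)
    rw [hfresh] at hn
    obtain rfl := Multiset.inj_on_of_nodup_map hn x hx x' hx' e'
    rfl
  let nm (p : {p : ι × Var P.sig // p.2 ∈ V p.1}) : Name P.Role :=
    ⟨p.1.2.idx, ro p.1.1, sessionId ro ms p.1.1⟩
  have hnm : Function.Injective nm := by
    rintro ⟨⟨j, x⟩, hx⟩ ⟨⟨j', x'⟩, hx'⟩ e
    obtain ⟨e₁, e₂, e₃⟩ := Name.mk.inj e
    obtain rfl := sessionId_injective e₂ e₃
    have hs := ((hV j x).1 hx).1.trans ((hV j x').1 hx').1.symm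
    obtain ⟨s, k⟩ := x
    obtain ⟨s', k'⟩ := x'
    obtain rfl : s = s' := hs
    obtain rfl : k = k' := e₁
    rfl
  -- Session numbers are at most `Fintype.card ι + 1`, hence this bound.
  obtain ⟨θ', δ, hθ', hδ⟩ := exists_fresh_names θ hvinj hnm (B := Fintype.card ι + 2)
    fun p => Nat.lt_succ_of_le (sessionId_le ro ms p.1.1)
  refine ⟨⟨ro, sessionId ro ms, L, fun j => sessionSubst (ro j) (sessionId ro ms j) (ρ j) θ', hL,
    fun j => respectsFresh_sessionSubst _ _ _ _⟩, θ', δ, hδ, fun j => ?_, fun ms₀ j h hj => ?_⟩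
  · rw [hinst j]
    refine instL_sessionSubst fun x hs hx => ?_
    change ((ρ j).toFun x).subst θ' = _
    rw [hv ⟨⟨j, x⟩, (hV j x).2 ⟨hs, hx⟩⟩]
    exact hθ' _
  · change sessionId ro ms j = _
    rw [maxId_sessionId ro ((List.prefix_append _ _).trans h), sessionId_of_prefix ro h hj]

end MaudeNPA

theorem mainTheorem4 (P : Protocol) (C₀ C : CState P) (θ : P.GSubst)
    (hC₀ : C₀.IsSymbolic) (hC : C.IsSymbolic)
    (hinit : C₀.IsInitial) (N : NarrowSeq C C₀) (hN : N.Consistent θ)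
    (hθ : Lifts C₀ θ (FState.init P)) :
    ∃ Fst : FState P, IsFWState Fst ∧ (∃ θ' : P.GSubst, Lifts C θ' Fst) ∧
      ∃ Pst : PState P, IsPAState Pst ∧ RelH Pst Fst := by
  -- Indexing by `Fin n` makes each occurrence of a strand in the multiset a session of its own.
  obtain ⟨n, A, hA⟩ : ∃ (n : ℕ) (A : Fin n → SymStrand P),
      C₀.strands = Finset.univ.val.map A := by
    obtain ⟨l, hl⟩ : ∃ l : List (SymStrand P), (l : Multiset (SymStrand P)) = C₀.strands :=
      Quotient.exists_rep C₀.strands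
    rw [← hl]
    exact ⟨l.length, l.get, by rw [Fin.univ_val_map, List.ofFn_get]⟩
  obtain ⟨ms, K, hS, hstr, hΨ, hK, hK'⟩ := N.exists_schedule hinit hA
  obtain ⟨D, θ', δ, rfl, hD, hid⟩ := hC₀.exists_sessions hA θ ms
  have hpast (j) : (A j).past = [] :=
    hinit.1 _ (hA ▸ Multiset.mem_map_of_mem A (Finset.mem_univ j))
  simp only [hpast, List.nil_append] at hD
  -- An equality under `θ'` would persist after applying `δ`.
  have hdiseq : ∀ d ∈ C₀.diseqs, d.1.subst θ' ≠ d.2.subst θ' := by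
    intro d hd e
    apply hθ.diseq d hd
    rw [← Message.subst_comp, e, Message.subst_comp]
  obtain ⟨α, hF, p, hp, hP⟩ := hS.reaches hD hdiseq (List.prefix_refl _) hid
  refine ⟨_, ⟨α, hF⟩, ⟨(N.rest 0).comp θ', ?_, ?_, ?_, ?_⟩,
    _, ⟨α, hP⟩, ⟨α, hP⟩, ⟨α, hF⟩, α, hP, hF⟩
  · intro B hB hne
    obtain ⟨j, -, hj⟩ := Multiset.mem_map.1 (Multiset.mem_of_le hstr
      (Multiset.mem_map_of_mem _ hB))
    have hj := (Prod.mk.inj hj).1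
    -- A strand with a nonempty past has executed some element, so its session has started.
    have hjms : j ∈ ms := by
      by_contra hjms
      rw [List.count_eq_zero_of_not_mem hjms] at hj
      exact hne (List.map_eq_nil_iff.1 hj.symm)
    refine ⟨_, D.mem_fstate _ hjms, ?_⟩
    have hD := congrArg (List.take (ms.count j)) (hD j)
    rw [instL, ← List.map_take, ← List.map_take, hj, List.map_map] at hD
    simp only [Function.comp_def, SMsg.map_map, Message.subst_comp] at hD
    exact hD
  · intro w hw
    exact ⟨_, hK ⟨w, hw, rfl⟩, Message.subst_comp _ _ _⟩
  -- The message `m` is a known fact of some state `k`; applying `δ` to the equality `e` contradicts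
  -- consistency.
  · rintro w hw ⟨m, hm, e⟩
    obtain ⟨k, hk, w', hw', rfl⟩ := hK' m hm
    refine hN k hk w' w hw' hw ?_
    rw [← Subst.comp_assoc, ← Subst.comp_assoc, ← Message.subst_comp _ _ δ,
      ← Message.subst_comp _ _ δ, ← e]
    simp only [Message.subst_comp]
  · intro d hd e
    refine hdiseq _ (hΨ ⟨d, hd, rfl⟩) ?_
    simpa only [Prod.map, Message.subst_comp] using e
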